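/- Let $N\ge 2$, let $\Omega\subset\mathbb R^N$ be open, and let $x_0\in\Omega$, $\rho>0$ be such that $B_{2\rho}(x_0)\subset\Omega$. Let $A:(0,\infty)\to(0,\infty)$ be of class $C^1$ with $\limsup_{t\to0^+}tA(t)<\infty$, $$-1<m_A:=\inf_{t>0}\frac{tA'(t)}{A(t)}\le M_A:=\sup_{t>0}\frac{tA'(t)}{A(t)}<\infty,$$ and suppose that there are $\tilde\vartheta\ge0$ and $K>0$ with $A(t)\ge K t^{\tilde\vartheta}$ for all $t>0$. Let $B:[0,\infty)\to[0,\infty)$ be of class $C^1$ with $B(0)=0$ and $B'(t)\le\hat C\,tA(t)$ for all $t>0$, for some $\hat C>0$. Let $u\in C^{1,\alpha}(\Omega)\cap C^2(\Omega\setminus\mathcal Z_u)$, where $\mathcal Z_u:=\{x\in\Omega:\nabla u(x)=0\}$, $\alpha\in(0,1]$, and $C^{1,\alpha}(\Omega)$ means that $\nabla u$ is $\alpha$-Hölder continuous on compact subsets of $\Omega$. Suppose that $u$ is a weak solution of $-\operatorname{div}(A(|\nabla u|)\nabla u)+B(|\nabla u|)=f$ in $\Omega$, i.e. $$\int_\Omega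 A(|\nabla u|)(\nabla u,\nabla\psi)\,dx+\int_\Omega B(|\nabla u|)\,\psi\,dx=\int_\Omega f\,\psi\,dx\qquad\text{for all }\psi\in C_c^\infty(\Omega),$$ where $f=f(x)\in W^{1,\infty}(\Omega)$ (in particular $f(x)$ may be a nonlinearity evaluated at $u(x)$), and suppose that for some $c>0$ either $f\ge c$ a.e. in $B_{2\rho}(x_0)$ or $f\le -c$ a.e. in $B_{2\rho}(x_0)$. Then for every $\sigma>1$ with $(\sigma-1)\tilde\vartheta<1$ (that is, $1<\sigma<1+1/\tilde\vartheta$, with no upper bound if $\tilde\vartheta=0$) and every real $\gamma$ with $\gamma<N-2$ if $N\ge3$, $\gamma=0$ if $N=2$, there is a finite constant $\mathcal C$ with $$\int_{B_\rho(x_0)}\frac{1}{A(|\nabla u|)^{\sigma}}\,\frac{1}{|x-y|^{\gamma}}\,dx\le\mathcal C\qquad\text{for all }y\in B_\rho(x_0).$$ If $|\nabla u|\le L<\infty$ in $B_{2\rho}(x_0)$, then $\mathcal C$ can be chosen to depend only on $N,x_0,\rho,\gamma,\sigma,m_A,M_A,K,\tilde\vartheta,\hat C$, on $c$ and an upper bound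 for $\|\nabla f\|_{L^\infty(\Omega)}$, on $L$, and on an upper bound $\Lambda$ for $tA(t)$ on $(0,L]$. Moreover, for every choice of a value $A(0)$, the set $\{x\in B_{2\rho}(x_0):A(|\nabla u(x)|)=0\}$ has Lebesgue measure zero, and $|\mathcal Z_u\cap B_{2\rho}(x_0)|=0$. -/

import Mathlib

open MeasureTheory Set Filter Topology
open scoped NNReal ENNReal ContDiff

/-- Euclidean space of dimension `N`. -/
abbrev RSpace (N : ℕ) : Type := EuclideanSpace ℝ (Fin N)

/-- `ψ` belongs to the space of smooth functions with compact support contained in `Ω`. -/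
def IsTestFunction {N : ℕ} (Ω : Set (RSpace N)) (ψ : RSpace N → ℝ) : Prop :=
  ContDiff ℝ ∞ ψ ∧ HasCompactSupport ψ ∧ tsupport ψ ⊆ Ω

/-- `g` is the weak (distributional) gradient of `f` on `Ω`. -/
def IsWeakGradient {N : ℕ} (Ω : Set (RSpace N)) (f : RSpace N → ℝ)
    (g : RSpace N → RSpace N) : Prop :=
  ∀ ψ : RSpace N → ℝ, IsTestFunction Ω ψ → ∀ v : RSpace N,
    ∫ x in Ω, f x * fderiv ℝ ψ x v = - ∫ x in Ω, inner ℝ (g x) v * ψ x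

/-- `f` belongs to the Sobolev space `W^{1,∞}(Ω)`, and its weak gradient is bounded by `F`
almost everywhere on `Ω`. -/
def MemSobolevOneInfty {N : ℕ} (Ω : Set (RSpace N)) (f : RSpace N → ℝ) (F : ℝ) : Prop :=
  MemLp f ∞ (volume.restrict Ω) ∧
  ∃ g : RSpace N → RSpace N,
    AEStronglyMeasurable g (volume.restrict Ω) ∧
    (∀ᵐ x ∂(volume.restrict Ω), ‖g x‖ ≤ F) ∧
    IsWeakGradient Ω f g

/-- The critical set of `u`. On an open set where `u` is differentiable `gradient u` is the
classical gradient. -/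
def criticalSet {N : ℕ} (u : RSpace N → ℝ) : Set (RSpace N) :=
  {x | gradient u x = 0}

/-- `u` is of class `C^{1,α}` on the open set `Ω` for some `α ∈ (0,1]`: it is `C^1` there and its
gradient is `α`-Hölder continuous on the compact subsets of `Ω`. -/
def IsCOneHolder {N : ℕ} (Ω : Set (RSpace N)) (u : RSpace N → ℝ) : Prop :=
  ContDiffOn ℝ 1 u Ω ∧
  ∃ α : ℝ≥0, 0 < α ∧ α ≤ 1 ∧
    ∀ S : Set (RSpace N), IsCompact S → S ⊆ Ω → ∃ C : ℝ≥0, HolderOnWith C α (gradient u) S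

/-- The assumptions on `A : (0,∞) → (0,∞)`; values of `A` outside `(0,∞)` are unrestricted.
Here `m` and `M` are the infimum and the supremum of `t A'(t) / A(t)`. -/
structure AdmissibleA (A : ℝ → ℝ) (m M K θ : ℝ) : Prop where
  contDiffOn : ContDiffOn ℝ 1 A (Ioi 0)
  pos : ∀ t, 0 < t → 0 < A t
  limsup_lt_top : limsup (fun t : ℝ => ((t * A t : ℝ) : EReal)) (𝓝[>] 0) < ⊤
  isGLB : IsGLB ((fun t : ℝ => t * deriv A t / A t) '' Ioi 0) m
  isLUB : IsLUB ((fun t : ℝ => t * deriv A t / A t) '' Ioi 0) M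
  neg_one_lt : -1 < m
  theta_nonneg : 0 ≤ θ
  K_pos : 0 < K
  lower_bound : ∀ t, 0 < t → K * t ^ θ ≤ A t

/-- The assumptions on `B : [0,∞) → [0,∞)`; values of `B` on `(-∞,0)` are unrestricted. -/
structure AdmissibleB (A B : ℝ → ℝ) (Chat : ℝ) : Prop where
  contDiffOn : ContDiffOn ℝ 1 B (Ici 0)
  nonneg : ∀ t, 0 ≤ t → 0 ≤ B t
  map_zero : B 0 = 0
  Chat_pos : 0 < Chat
  deriv_le : ∀ t, 0 < t → deriv B t ≤ Chat * (t * A t)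

/-- `u` satisfies `-div (A(|∇u|) ∇u) + B(|∇u|) = f` in `Ω` in the weak sense. At a critical point
of `u` the field `A(|∇u|) ∇u` is zero, whatever the value of `A` at `0`. -/
def IsWeakSolution {N : ℕ} (Ω : Set (RSpace N)) (A B : ℝ → ℝ) (f u : RSpace N → ℝ) : Prop :=
  ∀ ψ : RSpace N → ℝ, IsTestFunction Ω ψ →
    (∫ x in Ω, A ‖gradient u x‖ * inner ℝ (gradient u x) (gradient ψ x)) +
      (∫ x in Ω, B ‖gradient u x‖ * ψ x) = ∫ x in Ω, f x * ψ x

/-- The standing data: an open set `Ω` containing the ball `B_{2ρ}(x₀)`, admissible `A` and `B`, a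
source `f ∈ W^{1,∞}(Ω)` (a function of the point, such as `x ↦ g (u x)`) that on `B_{2ρ}(x₀)` is
either at least `c` or at most `-c`, and a weak solution `u ∈ C^{1,α}(Ω) ∩ C²(Ω \ Z_u)`. -/
structure IsSignedSolution {N : ℕ} (x₀ : RSpace N) (ρ m M K θ Chat c F : ℝ)
    (Ω : Set (RSpace N)) (A B : ℝ → ℝ) (f u : RSpace N → ℝ) : Prop where
  isOpen : IsOpen Ω
  ball_subset : Metric.ball x₀ (2 * ρ) ⊆ Ω
  admissibleA : AdmissibleA A m M K θ
  admissibleB : AdmissibleB A B Chat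
  memSobolev : MemSobolevOneInfty Ω f F
  sign : (∀ᵐ x ∂(volume.restrict (Metric.ball x₀ (2 * ρ))), c ≤ f x) ∨
    (∀ᵐ x ∂(volume.restrict (Metric.ball x₀ (2 * ρ))), f x ≤ -c)
  cOneHolder : IsCOneHolder Ω u
  cTwo : ContDiffOn ℝ 2 u (Ω \ criticalSet u)
  weakSolution : IsWeakSolution Ω A B f u

/-- The integral over `B_ρ(x₀)` of `A(|∇u|)^{-σ} |x - y|^{-γ}`, with values in `[0,∞]`. A base that
is zero (or negative) and has a negative exponent gives the value `∞`. -/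
noncomputable def inverseWeightIntegral {N : ℕ} (x₀ : RSpace N) (ρ : ℝ) (A : ℝ → ℝ)
    (u : RSpace N → ℝ) (σ γ : ℝ) (y : RSpace N) : ℝ≥0∞ :=
  ∫⁻ x in Metric.ball x₀ ρ,
    ENNReal.ofReal (A ‖gradient u x‖) ^ (-σ) * ENNReal.ofReal ‖x - y‖ ^ (-γ)

/-! Write V = A(|∇u|)∇u, so that |V| = |∇u| A(|∇u|). The core of the proof is the local summability
of |V|^(-τ) for every 0 < τ < 1, with a bound in terms of the energy ∫ (ζ² + |∇ζ|²) of the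
localizing function ζ.

The equation differentiated along each basis vector e_i is tested with u_i A |V|^(-τ) ζ², times a
cutoff that vanishes for |∇u| ≤ d, and summed over i. The principal part is coercive because m > -1
and τ < 1; the decisive algebraic fact is `sq_norm_add_le_sqFrobenius`. This gives
`second_order_estimate`: ∫ A² |V|^(-τ) |D²u|² ζ² is bounded by the energy of ζ, uniformly in d.

Next the equation itself is tested with a truncation of |V|^(-τ) ζ². Since f has a sign, the source
term controls c ∫ |V|^(-τ) ζ². The derivative of |V|^(-τ) costs at most a multiple of |V|^(-τ) A
|D²u| ζ², which Young's inequality splits into a part that is absorbed and the Hessian integral just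
bounded (`integral_powerTest_le`). Fatou's lemma removes the truncation (`lintegral_rpow_le`). As
|V|^(-τ) = ∞ on the critical set, that set is null (`volume_criticalSet`).

Taking for ζ² a regularization of |x - y|^(-γ) inserts the kernel: the energy is then controlled by
the integral of |x - y|^(-γ-2), finite for γ < N - 2 (`exists_kernel_cutoff`). Finally A(t) ≥ K t^θ
bounds A^(-σ) by a multiple of t^(τ - θ(σ-τ)) |V|^(-τ) (`AdmissibleA.rpow_neg_le`), and some τ < 1
makes this exponent of t nonnegative precisely when (σ-1)θ < 1. -/

/-! ### Weak identities for `C^1` test functions -/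

/-- Mollification with a small bump. One compact set `S` serves every ε, so that the error in a weak
identity can be integrated over a fixed set. -/
theorem exists_contDiff_infty_approx {N : ℕ} {U : Set (RSpace N)} (hU : IsOpen U)
    {ψ : RSpace N → ℝ} (hψ : ContDiff ℝ 1 ψ) (hc : HasCompactSupport ψ) (hs : tsupport ψ ⊆ U) :
    ∃ S : Set (RSpace N), IsCompact S ∧ S ⊆ U ∧ tsupport ψ ⊆ S ∧ ∀ ε : ℝ, 0 < ε →
      ∃ φ : RSpace N → ℝ, ContDiff ℝ ∞ φ ∧ tsupport φ ⊆ S ∧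
        (∀ x, |φ x - ψ x| ≤ ε) ∧ ∀ x, ‖gradient φ x - gradient ψ x‖ ≤ ε := by
  obtain ⟨δ, hδ, hδU⟩ := IsCompact.exists_cthickening_subset_open hc hU hs
  refine ⟨Metric.cthickening δ (tsupport ψ), hc.isCompact.cthickening, hδU,
    Metric.self_subset_cthickening _, fun ε hε => ?_⟩
  have hψ' : Continuous (fderiv ℝ ψ) := hψ.continuous_fderiv one_ne_zero
  have hu1 : UniformContinuous ψ := hc.uniformContinuous_of_continuous hψ.continuous
  have hu2 : UniformContinuous (fderiv ℝ ψ) :=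
    (hc.fderiv (𝕜 := ℝ)).uniformContinuous_of_continuous hψ'
  obtain ⟨δ₁, hδ₁, h1⟩ := Metric.uniformContinuous_iff_le.1 hu1 ε hε
  obtain ⟨δ₂, hδ₂, h2⟩ := Metric.uniformContinuous_iff_le.1 hu2 ε hε
  set r := min δ (min δ₁ δ₂) with hr
  have hr0 : 0 < r := lt_min hδ (lt_min hδ₁ hδ₂)
  let b : ContDiffBump (0 : RSpace N) := ⟨r / 2, r, by positivity, by linarith⟩
  have hb : LocallyIntegrable (b.normed volume) volume := b.continuous_normed.locallyIntegrable
  set φ : RSpace N → ℝ :=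
    MeasureTheory.convolution (b.normed volume) ψ (ContinuousLinearMap.lsmul ℝ ℝ) volume with hφ
  have hder : ∀ x, fderiv ℝ φ x = MeasureTheory.convolution (b.normed volume) (fderiv ℝ ψ)
      (ContinuousLinearMap.lsmul ℝ ℝ) volume x := by
    intro x
    rw [(hc.hasFDerivAt_convolution_right (ContinuousLinearMap.lsmul ℝ ℝ) hb hψ x).fderiv]
    rfl
  refine ⟨φ, ?_, ?_, fun x => ?_, fun x => ?_⟩
  · exact b.hasCompactSupport_normed.contDiff_convolution_left _ b.contDiff_normed
      hψ.continuous.locallyIntegrable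
  · refine closure_minimal ?_ Metric.isClosed_cthickening
    refine (support_convolution_subset _).trans ?_
    rw [b.support_normed_eq]
    rintro _ ⟨y, hy, z, hz, rfl⟩
    refine Metric.mem_cthickening_of_dist_le _ z _ _ (subset_tsupport _ hz) ?_
    have : dist y 0 < r := hy
    rw [dist_zero_right] at this
    simp only [dist_eq_norm, add_sub_cancel_right]
    exact this.le.trans (min_le_left _ _)
  · have := b.dist_normed_convolution_le (μ := volume) (x₀ := x) (ε := ε)
      hψ.continuous.aestronglyMeasurable (fun y hy => h1 ?_)
    · rwa [Real.dist_eq] at this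
    · exact (le_of_lt hy).trans ((min_le_right _ _).trans (min_le_left _ _))
  · have := b.dist_normed_convolution_le (μ := volume) (x₀ := x) (ε := ε)
      hψ'.aestronglyMeasurable (fun y hy => h2 ?_)
    · rw [← hder, dist_eq_norm] at this
      rw [gradient, gradient, ← map_sub, LinearIsometryEquiv.norm_map]
      exact this
    · exact (le_of_lt hy).trans ((min_le_right _ _).trans (min_le_right _ _))

theorem gradient_eq_zero_of_notMem_tsupport {N : ℕ} {ψ : RSpace N → ℝ} {x : RSpace N}
    (hx : x ∉ tsupport ψ) : gradient ψ x = 0 := by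
  rw [gradient, image_eq_zero_of_notMem_tsupport fun h => hx (tsupport_fderiv_subset ℝ h),
    map_zero]

theorem continuous_gradient {N : ℕ} {ψ : RSpace N → ℝ} (hψ : ContDiff ℝ 1 ψ) :
    Continuous (gradient ψ) :=
  (LinearIsometryEquiv.continuous _).comp (hψ.continuous_fderiv one_ne_zero)

theorem setIntegral_eq_of_tsupport {N : ℕ} {Ω S : Set (RSpace N)} (hΩ : MeasurableSet Ω)
    (hSΩ : S ⊆ Ω) {P : RSpace N → ℝ} (hP : ∀ x, x ∉ S → P x = 0) :
    ∫ x in Ω, P x = ∫ x in S, P x :=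
  setIntegral_eq_of_subset_of_forall_sdiff_eq_zero hΩ hSΩ fun x hx => hP x hx.2

theorem integrableOn_weak_pairing {N : ℕ} {S : Set (RSpace N)}
    (hS : IsCompact S) {X : RSpace N → RSpace N} {Y : RSpace N → ℝ}
    (hX : IntegrableOn X S) (hY : IntegrableOn Y S) {ψ : RSpace N → ℝ} (hψ : ContDiff ℝ 1 ψ) :
    IntegrableOn (fun x => inner ℝ (X x) (gradient ψ x) + Y x * ψ x) S := by
  refine Integrable.add ?_ ?_
  · obtain ⟨C, hC⟩ := hS.exists_bound_of_continuousOn (continuous_gradient hψ).continuousOn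
    refine Integrable.mono' (hX.norm.mul_const C)
      (hX.aestronglyMeasurable.inner (continuous_gradient hψ).aestronglyMeasurable) ?_
    filter_upwards [ae_restrict_mem hS.measurableSet] with x hx
    exact (norm_inner_le_norm _ _).trans (mul_le_mul_of_nonneg_left (hC x hx) (norm_nonneg _))
  · obtain ⟨C, hC⟩ := hS.exists_bound_of_continuousOn hψ.continuous.continuousOn
    refine Integrable.mono' (hY.norm.mul_const C)
      (hY.aestronglyMeasurable.mul hψ.continuous.aestronglyMeasurable) ?_
    filter_upwards [ae_restrict_mem hS.measurableSet] with x hx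
    rw [norm_mul]
    exact mul_le_mul_of_nonneg_left (hC x hx) (norm_nonneg _)

/-- A weak identity against smooth test functions extends to `C^1` test functions. -/
theorem weak_identity_of_contDiff_one {N : ℕ} {Ω U : Set (RSpace N)} (hΩ : MeasurableSet Ω)
    (hU : IsOpen U) (hUΩ : U ⊆ Ω) {X : RSpace N → RSpace N} {Y : RSpace N → ℝ}
    (hX : ∀ S, IsCompact S → S ⊆ U → IntegrableOn X S)
    (hY : ∀ S, IsCompact S → S ⊆ U → IntegrableOn Y S)
    (h : ∀ ψ, IsTestFunction U ψ →
      ∫ x in Ω, (inner ℝ (X x) (gradient ψ x) + Y x * ψ x) = 0)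
    {ψ : RSpace N → ℝ} (hψ : ContDiff ℝ 1 ψ) (hc : HasCompactSupport ψ) (hs : tsupport ψ ⊆ U) :
    ∫ x in Ω, (inner ℝ (X x) (gradient ψ x) + Y x * ψ x) = 0 := by
  obtain ⟨S, hS, hSU, hψS, happ⟩ := exists_contDiff_infty_approx hU hψ hc hs
  have hzero : ∀ φ : RSpace N → ℝ, tsupport φ ⊆ S → ∀ x, x ∉ S →
      inner ℝ (X x) (gradient φ x) + Y x * φ x = 0 := by
    intro φ hφ x hx
    rw [gradient_eq_zero_of_notMem_tsupport fun h => hx (hφ h),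
      image_eq_zero_of_notMem_tsupport fun h => hx (hφ h)]
    simp
  have hXS := hX S hS hSU
  have hYS := hY S hS hSU
  rw [setIntegral_eq_of_tsupport hΩ (hSU.trans hUΩ) (hzero ψ hψS)]
  set Q := ∫ x in S, (‖X x‖ + ‖Y x‖) with hQ
  have hQ0 : 0 ≤ Q := integral_nonneg fun x => by positivity
  have key : ∀ ε : ℝ, 0 < ε →
      ‖∫ x in S, (inner ℝ (X x) (gradient ψ x) + Y x * ψ x)‖ ≤ ε * Q := by
    intro ε hε
    obtain ⟨φ, hφ, hφS, hd, hg⟩ := happ ε hε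
    have h0 := h φ ⟨hφ, hS.of_isClosed_subset (isClosed_tsupport _) hφS, hφS.trans hSU⟩
    rw [setIntegral_eq_of_tsupport hΩ (hSU.trans hUΩ) (hzero φ hφS)] at h0
    have hφ1 : ContDiff ℝ 1 φ := hφ.of_le (by exact_mod_cast le_top)
    have e : ∫ x in S, (inner ℝ (X x) (gradient ψ x) + Y x * ψ x) =
        ∫ x in S, ((inner ℝ (X x) (gradient ψ x) + Y x * ψ x) -
          (inner ℝ (X x) (gradient φ x) + Y x * φ x)) := by
      rw [integral_sub (integrableOn_weak_pairing hS hXS hYS hψ)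
        (integrableOn_weak_pairing hS hXS hYS hφ1), h0, sub_zero]
    rw [e, hQ, ← integral_const_mul]
    refine norm_integral_le_of_norm_le ((hXS.norm.add hYS.norm).const_mul ε)
      (Eventually.of_forall fun x => ?_)
    have : (inner ℝ (X x) (gradient ψ x) + Y x * ψ x) -
          (inner ℝ (X x) (gradient φ x) + Y x * φ x) =
        -(inner ℝ (X x) (gradient φ x - gradient ψ x) + Y x * (φ x - ψ x)) := by
      rw [inner_sub_right]; ring
    rw [this, norm_neg]
    refine (norm_add_le _ _).trans ?_
    have h1 := (norm_inner_le_norm (𝕜 := ℝ) (X x) (gradient φ x - gradient ψ x)).trans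
      (mul_le_mul_of_nonneg_left (hg x) (norm_nonneg _))
    have h2 : ‖Y x * (φ x - ψ x)‖ ≤ ‖Y x‖ * ε := by
      rw [norm_mul]; exact mul_le_mul_of_nonneg_left (hd x) (norm_nonneg _)
    linarith
  rw [← norm_le_zero_iff]
  refine le_of_forall_pos_le_add fun ε hε => ?_
  have := key (ε / (Q + 1)) (by positivity)
  refine this.trans ?_
  rw [zero_add, div_mul_eq_mul_div, div_le_iff₀ (by positivity)]
  nlinarith

/-! ### Consequences of the structural assumptions on A and B -/

namespace AdmissibleA

variable {A : ℝ → ℝ} {m M K θ : ℝ}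

theorem hasDerivAt (hA : AdmissibleA A m M K θ) {t : ℝ} (ht : 0 < t) :
    HasDerivAt A (deriv A t) t :=
  ((hA.contDiffOn.differentiableOn one_ne_zero).differentiableAt (Ioi_mem_nhds ht)).hasDerivAt

theorem le_mul_deriv (hA : AdmissibleA A m M K θ) {t : ℝ} (ht : 0 < t) :
    m * A t ≤ t * deriv A t := by
  have := hA.isGLB.1 (mem_image_of_mem (fun t => t * deriv A t / A t) (mem_Ioi.2 ht))
  rwa [le_div_iff₀ (hA.pos t ht)] at this

theorem mul_deriv_le (hA : AdmissibleA A m M K θ) {t : ℝ} (ht : 0 < t) :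
    t * deriv A t ≤ M * A t := by
  have := hA.isLUB.1 (mem_image_of_mem (fun t => t * deriv A t / A t) (mem_Ioi.2 ht))
  rwa [div_le_iff₀ (hA.pos t ht)] at this

theorem hasDerivAt_mul (hA : AdmissibleA A m M K θ) {t : ℝ} (ht : 0 < t) :
    HasDerivAt (fun t => t * A t) (A t + t * deriv A t) t := by
  have h : HasDerivAt (fun t => t * A t) (1 * A t + t * deriv A t) t :=
    (hasDerivAt_id' t).mul (hA.hasDerivAt ht)
  rwa [one_mul] at h

theorem monotoneOn_mul (hA : AdmissibleA A m M K θ) :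
    MonotoneOn (fun t => t * A t) (Ioi 0) := by
  refine monotoneOn_of_deriv_nonneg (convex_Ioi 0)
    (fun t ht => (hA.hasDerivAt_mul ht).continuousAt.continuousWithinAt)
    (fun t ht => ?_) (fun t ht => ?_)
  · rw [interior_Ioi] at ht
    exact (hA.hasDerivAt_mul ht).differentiableAt.differentiableWithinAt
  · rw [interior_Ioi] at ht
    rw [(hA.hasDerivAt_mul ht).deriv]
    nlinarith [hA.le_mul_deriv ht, hA.pos t ht, hA.neg_one_lt]

theorem monotoneOn_rpow_mul (hA : AdmissibleA A m M K θ) :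
    MonotoneOn (fun t => t ^ (-m) * A t) (Ioi 0) := by
  have hd : ∀ t : ℝ, 0 < t → HasDerivAt (fun t => t ^ (-m) * A t)
      (-m * t ^ (-m - 1) * A t + t ^ (-m) * deriv A t) t := fun t ht =>
    (Real.hasDerivAt_rpow_const (Or.inl ht.ne')).mul (hA.hasDerivAt ht)
  refine monotoneOn_of_deriv_nonneg (convex_Ioi 0)
    (fun t ht => (hd t ht).continuousAt.continuousWithinAt)
    (fun t ht => ?_) (fun t ht => ?_)
  · rw [interior_Ioi] at ht
    exact (hd t ht).differentiableAt.differentiableWithinAt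
  · rw [interior_Ioi] at ht
    have ht' : 0 < t := ht
    rw [(hd t ht).deriv, Real.rpow_sub_one ht'.ne']
    have h1 := hA.le_mul_deriv ht
    have h2 : 0 ≤ t ^ (-m) / t * (t * deriv A t - m * A t) :=
      mul_nonneg (by positivity) (by linarith)
    have h3 : t ^ (-m) / t * (t * deriv A t - m * A t) =
        -m * (t ^ (-m) / t) * A t + t ^ (-m) * deriv A t := by
      field_simp; ring
    linarith

/-- `t A(t)` vanishes as `t → 0`. -/
theorem exists_mul_lt (hA : AdmissibleA A m M K θ) {ε : ℝ} (hε : 0 < ε) :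
    ∃ δ, 0 < δ ∧ ∀ t, 0 < t → t ≤ δ → t * A t < ε := by
  have hA1 := hA.pos 1 one_pos
  have hm := hA.neg_one_lt
  -- As t^(-m) A(t) is increasing, t A(t) ≤ A(1) t^(1+m) on (0,1], and 1 + m > 0.
  have hlim : Tendsto (fun t : ℝ => A 1 * t ^ (1 + m)) (𝓝 0) (𝓝 0) := by
    have : ContinuousAt (fun t : ℝ => A 1 * t ^ (1 + m)) 0 :=
      continuousAt_const.mul (Real.continuousAt_rpow_const _ _ (Or.inr (by linarith)))
    simpa [ContinuousAt, Real.zero_rpow (by linarith : 1 + m ≠ 0)] using this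
  obtain ⟨δ, hδ, h⟩ := Metric.eventually_nhds_iff.1 (hlim.eventually (gt_mem_nhds hε))
  refine ⟨min (δ / 2) 1, by positivity, fun t ht htδ => ?_⟩
  have h1 : t ≤ δ / 2 := htδ.trans (min_le_left _ _)
  have h2 : t ≤ 1 := htδ.trans (min_le_right _ _)
  have h3 := h (y := t) (by rw [Real.dist_eq, sub_zero, abs_of_pos ht]; linarith)
  have h4 := hA.monotoneOn_rpow_mul (mem_Ioi.2 ht) (mem_Ioi.2 one_pos) h2
  simp only [Real.one_rpow, one_mul] at h4
  have h5 : t ^ (1 + m) * (t ^ (-m) * A t) = t * A t := by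
    rw [← mul_assoc, ← Real.rpow_add ht]; simp
  have := mul_le_mul_of_nonneg_left h4 (by positivity : (0 : ℝ) ≤ t ^ (1 + m))
  nlinarith

/-- Mean value inequality on [0,t]: since s A(s) is increasing, the bound on B' at any s < t is at
most `Chat * (t * A t)`. -/
theorem lowerOrder_le (hA : AdmissibleA A m M K θ) {B : ℝ → ℝ} {Chat : ℝ}
    (hB : AdmissibleB A B Chat) {t : ℝ} (ht : 0 ≤ t) : B t ≤ Chat * (t ^ 2 * A t) := by
  rcases ht.eq_or_lt with rfl | ht
  · simp [hB.map_zero]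
  have := Convex.image_sub_le_mul_sub_of_deriv_le (convex_Icc 0 t) (f := B)
    (C := Chat * (t * A t)) (hB.contDiffOn.continuousOn.mono Icc_subset_Ici_self)
    (fun s hs => ?_) (fun s hs => ?_) 0 (left_mem_Icc.2 ht.le) t (right_mem_Icc.2 ht.le) ht.le
  · rw [hB.map_zero] at this
    linarith
  · rw [interior_Icc] at hs
    exact ((hB.contDiffOn.differentiableOn one_ne_zero).differentiableAt
      (Ici_mem_nhds hs.1)).differentiableWithinAt
  · rw [interior_Icc] at hs
    refine (hB.deriv_le s hs.1).trans (mul_le_mul_of_nonneg_left ?_ hB.Chat_pos.le)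
    exact hA.monotoneOn_mul hs.1 ht hs.2.le

end AdmissibleA

/-! ### One-variable `C^1` cutoffs and truncated powers -/

theorem hasDerivAt_max_zero_sq (x : ℝ) :
    HasDerivAt (fun x : ℝ => max x 0 ^ 2) (2 * max x 0) x := by
  rcases lt_trichotomy x 0 with hx | rfl | hx
  · have : (fun x : ℝ => max x 0 ^ 2) =ᶠ[𝓝 x] fun _ => 0 := by
      filter_upwards [Iio_mem_nhds hx] with y hy
      simp [max_eq_right (le_of_lt hy : y ≤ 0)]
    rw [max_eq_right hx.le, mul_zero]
    exact (hasDerivAt_const x 0).congr_of_eventuallyEq this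
  · rw [hasDerivAt_iff_isLittleO_nhds_zero]
    simp only [zero_add, max_self, mul_zero, smul_eq_mul, sub_zero]
    have h1 : (fun h : ℝ => max h 0 ^ 2 - 0 ^ 2) =O[𝓝 0] fun h : ℝ => h ^ 2 := by
      refine Asymptotics.IsBigO.of_bound 1 (Eventually.of_forall fun h => ?_)
      rw [one_mul, zero_pow two_ne_zero, sub_zero, Real.norm_of_nonneg (by positivity),
        Real.norm_of_nonneg (by positivity)]
      rcases le_total h 0 with hh | hh
      · simp [max_eq_right hh, sq_nonneg]
      · simp [max_eq_left hh]
    exact h1.trans_isLittleO (Asymptotics.isLittleO_pow_id one_lt_two)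
  · have : (fun x : ℝ => max x 0 ^ 2) =ᶠ[𝓝 x] fun x => x ^ 2 := by
      filter_upwards [Ioi_mem_nhds hx] with y hy
      rw [max_eq_left (le_of_lt hy : (0 : ℝ) ≤ y)]
    rw [max_eq_left hx.le]
    simpa using (hasDerivAt_pow 2 x).congr_of_eventuallyEq this

theorem contDiff_max_zero_sq : ContDiff ℝ 1 (fun x : ℝ => max x 0 ^ 2) := by
  rw [contDiff_one_iff_deriv]
  refine ⟨fun x => (hasDerivAt_max_zero_sq x).differentiableAt, ?_⟩
  rw [funext fun x => (hasDerivAt_max_zero_sq x).deriv]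
  fun_prop

/-- A `C^1` cutoff on `(0,∞)` that vanishes for `t ≤ d` and tends to `1` as `d → 0`. -/
noncomputable def cutoffRatio (d t : ℝ) : ℝ := max (t - d) 0 ^ 2 / t ^ 2

/-- The derivative of `cutoffRatio d` at `t > 0`. -/
noncomputable def cutoffRatioDeriv (d t : ℝ) : ℝ := 2 * max (t - d) 0 * d / t ^ 3

theorem hasDerivAt_cutoffRatio {d t : ℝ} (ht : 0 < t) :
    HasDerivAt (cutoffRatio d) (cutoffRatioDeriv d t) t := by
  have h1 : HasDerivAt (fun t : ℝ => max (t - d) 0 ^ 2) (2 * max (t - d) 0) t := by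
    have h := (hasDerivAt_max_zero_sq (t - d)).comp t ((hasDerivAt_id t).sub_const d)
    rwa [mul_one] at h
  have h2 := h1.div (hasDerivAt_pow 2 t) (by positivity)
  refine h2.congr_deriv ?_
  rw [cutoffRatioDeriv]
  rcases le_total (t - d) 0 with h | h
  · simp [max_eq_right h]
  · rw [max_eq_left h]
    field_simp
    simp
    ring

theorem contDiffOn_cutoffRatio (d : ℝ) : ContDiffOn ℝ 1 (cutoffRatio d) (Ioi 0) :=
  ((contDiff_max_zero_sq.comp (contDiff_id.sub contDiff_const)).contDiffOn).div
    (contDiff_id.pow 2).contDiffOn fun t ht => by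
      have : (0 : ℝ) < t := ht
      positivity

theorem cutoffRatio_nonneg (d t : ℝ) : 0 ≤ cutoffRatio d t := by
  unfold cutoffRatio; positivity

theorem cutoffRatio_le_one {d t : ℝ} (hd : 0 < d) (ht : 0 < t) : cutoffRatio d t ≤ 1 := by
  rw [cutoffRatio, div_le_one (by positivity)]
  exact pow_le_pow_left₀ (le_max_right _ _) (max_le (by linarith) ht.le) 2

theorem cutoffRatio_eq_zero {d t : ℝ} (h : t ≤ d) : cutoffRatio d t = 0 := by
  rw [cutoffRatio, max_eq_right (by linarith)]; simp

/-- Allows the cutoff to be inserted, at the cost of a factor 4, wherever |∇u| ≥ 2d. -/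
theorem le_cutoffRatio {d t : ℝ} (hd : 0 < d) (h : 2 * d ≤ t) : 1 ≤ 4 * cutoffRatio d t := by
  have ht : 0 < t := by linarith
  rw [cutoffRatio, max_eq_left (by linarith), mul_div_assoc', le_div_iff₀ (by positivity)]
  nlinarith

theorem cutoffRatioDeriv_nonneg {d t : ℝ} (hd : 0 < d) (ht : 0 < t) :
    0 ≤ cutoffRatioDeriv d t := by
  unfold cutoffRatioDeriv; positivity

/-- The cutoff depends only on t/d, so its scale-invariant derivative is bounded independently of d.
This keeps the second-order estimate uniform in d. -/
theorem mul_cutoffRatioDeriv_le {d t : ℝ} (hd : 0 < d) (ht : 0 < t) :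
    t * cutoffRatioDeriv d t ≤ 2 := by
  rw [cutoffRatioDeriv, mul_div_assoc', div_le_iff₀ (by positivity)]
  rcases le_total (t - d) 0 with h | h
  · simp [max_eq_right h]; positivity
  · rw [max_eq_left h]
    nlinarith [mul_nonneg h hd.le, mul_nonneg h h, mul_pos ht ht,
      mul_nonneg ht.le (mul_nonneg h hd.le), mul_nonneg ht.le (mul_nonneg h h),
      mul_nonneg ht.le (mul_nonneg hd.le hd.le)]

/-- A `C^1` truncation of `v ↦ v^(-τ)` that is constant for `v ≤ ε`. -/
noncomputable def truncatedPower (τ ε v : ℝ) : ℝ := (ε ^ 2 + max (v - ε) 0 ^ 2) ^ (-τ / 2)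

/-- The derivative of `truncatedPower τ ε`. -/
noncomputable def truncatedPowerDeriv (τ ε v : ℝ) : ℝ :=
  -τ * max (v - ε) 0 * (ε ^ 2 + max (v - ε) 0 ^ 2) ^ (-τ / 2 - 1)

theorem hasDerivAt_truncatedPower {τ ε : ℝ} (hε : 0 < ε) (v : ℝ) :
    HasDerivAt (truncatedPower τ ε) (truncatedPowerDeriv τ ε v) v := by
  have h1 : HasDerivAt (fun t : ℝ => ε ^ 2 + max (t - ε) 0 ^ 2) (2 * max (v - ε) 0) v := by
    have h := ((hasDerivAt_max_zero_sq (v - ε)).comp v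
      ((hasDerivAt_id v).sub_const ε)).const_add (ε ^ 2)
    rwa [mul_one] at h
  have h2 := h1.rpow_const (p := -τ / 2) (Or.inl (by positivity))
  refine h2.congr_deriv ?_
  rw [truncatedPowerDeriv]; ring

theorem contDiff_truncatedPower {τ ε : ℝ} (hε : 0 < ε) : ContDiff ℝ 1 (truncatedPower τ ε) :=
  (contDiff_const.add (contDiff_max_zero_sq.comp (contDiff_id.sub contDiff_const))).rpow_const_of_ne
    fun v => by
      have : (0 : ℝ) < ε ^ 2 := by positivity
      simp only [Function.comp]
      positivity

theorem truncatedPower_pos {τ ε : ℝ} (hε : 0 < ε) (v : ℝ) : 0 < truncatedPower τ ε v := by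
  unfold truncatedPower; positivity

theorem truncatedPowerDeriv_eq_zero {τ ε v : ℝ} (h : v ≤ ε) : truncatedPowerDeriv τ ε v = 0 := by
  rw [truncatedPowerDeriv, max_eq_right (by linarith)]; simp

theorem truncatedPower_of_le {τ ε v : ℝ} (hε : 0 < ε) (h : v ≤ ε) :
    truncatedPower τ ε v = ε ^ (-τ) := by
  rw [truncatedPower, max_eq_right (by linarith), zero_pow two_ne_zero, add_zero,
    ← Real.rpow_natCast, ← Real.rpow_mul hε.le]
  congr 1
  push_cast
  ring

/-- A bound on the logarithmic derivative that does not depend on ε, as for the pure power v^(-τ).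
-/
theorem abs_truncatedPowerDeriv_mul_le {τ ε v : ℝ} (hτ : 0 < τ) (hτ1 : τ < 1) (hε : 0 < ε)
    (_hv : 0 ≤ v) : |truncatedPowerDeriv τ ε v| * v ≤ 2 * truncatedPower τ ε v := by
  have hp : 0 < ε ^ 2 + max (v - ε) 0 ^ 2 := by positivity
  rw [truncatedPowerDeriv, truncatedPower, Real.rpow_sub_one hp.ne', abs_mul, abs_mul, abs_neg,
    abs_of_pos hτ, abs_of_nonneg (le_max_right (v - ε) 0), abs_of_nonneg (by positivity)]
  set P := (ε ^ 2 + max (v - ε) 0 ^ 2) ^ (-τ / 2) with hP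
  have hP0 : 0 < P := by positivity
  rw [mul_div_assoc', div_mul_eq_mul_div, div_le_iff₀ hp]
  have h3 : τ * max (v - ε) 0 * v ≤ 2 * (ε ^ 2 + max (v - ε) 0 ^ 2) := by
    rcases le_total (v - ε) 0 with h | h
    · simp [max_eq_right h]; positivity
    · rw [max_eq_left h]
      nlinarith [mul_nonneg h _hv, sq_nonneg (v - 2 * ε), sq_nonneg v]
  nlinarith

/-- The base of the truncation is at least (v/2)², and 2^τ ≤ 2. -/
theorem truncatedPower_le {τ ε v : ℝ} (hτ : 0 < τ) (hτ1 : τ < 1) (hε : 0 < ε) (hv : 0 < v) :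
    truncatedPower τ ε v ≤ 2 * v ^ (-τ) := by
  have h1 : (v / 2) ^ 2 ≤ ε ^ 2 + max (v - ε) 0 ^ 2 := by
    rcases le_total (v - ε) 0 with h | h
    · nlinarith [sq_nonneg (max (v - ε) 0)]
    · rw [max_eq_left h]; nlinarith [sq_nonneg (v - 2 * ε)]
  have h2 : truncatedPower τ ε v ≤ ((v / 2) ^ 2) ^ (-τ / 2) :=
    Real.rpow_le_rpow_of_nonpos (by positivity) h1 (by linarith)
  have h3 : ((v / 2) ^ 2) ^ (-τ / 2) = 2 ^ τ * v ^ (-τ) := by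
    rw [← Real.rpow_natCast, ← Real.rpow_mul (by positivity), Real.div_rpow hv.le (by norm_num)]
    have : ((2 : ℕ) : ℝ) * (-τ / 2) = -τ := by push_cast; ring
    rw [this, Real.rpow_neg (by norm_num : (0 : ℝ) ≤ 2), div_inv_eq_mul, mul_comm]
  have h4 : (2 : ℝ) ^ τ ≤ 2 := by
    conv_rhs => rw [← Real.rpow_one 2]
    exact Real.rpow_le_rpow_of_exponent_le (by norm_num) hτ1.le
  rw [h3] at h2
  exact h2.trans (mul_le_mul_of_nonneg_right h4 (by positivity))

/-! ### Trace identities and inequalities for the Hessian -/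

section LinearAlgebra

variable {ι E : Type*} [Fintype ι] [NormedAddCommGroup E] [InnerProductSpace ℝ E]
  (b : OrthonormalBasis ι ℝ E)

/-- The squared Hilbert--Schmidt norm of `H` computed in the orthonormal basis `b`. -/
noncomputable def sqFrobenius (H : E →L[ℝ] E) : ℝ := ∑ i, ‖H (b i)‖ ^ 2

theorem sqFrobenius_nonneg (H : E →L[ℝ] E) : 0 ≤ sqFrobenius b H :=
  Finset.sum_nonneg fun _ _ => by positivity

theorem sum_inner_smul_apply (H : E →L[ℝ] E) (G : E) :
    ∑ i, inner ℝ G (b i) • H (b i) = H G := by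
  conv_rhs => rw [← b.sum_repr' G, map_sum]
  exact Finset.sum_congr rfl fun i _ => by rw [map_smul, real_inner_comm]

/-- The principal part of the summed differentiated equations, Σ ⟨∂_i V, ∇(u_i Φ)⟩, with H = D²u, G
= ∇u, t = |∇u|, s = ∇|∇u|, a₀ = A(t), a₁ = A'(t) and W = ∇Φ. -/
theorem sum_pairing_eq {H : E →L[ℝ] E} (hH : ∀ v w, inner ℝ (H v) w = inner ℝ (H w) v)
    {G s W : E} {t a₀ a₁ Φ : ℝ} (hs : t • s = H G) :
    ∑ i, inner ℝ (a₀ • H (b i) + (a₁ * inner ℝ s (b i)) • G)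
        (Φ • H (b i) + inner ℝ G (b i) • W) =
      Φ * (a₀ * sqFrobenius b H + a₁ * t * ‖s‖ ^ 2) + a₀ * t * inner ℝ s W +
        a₁ * inner ℝ s G * inner ℝ G W := by
  have h1 : ∀ i, inner ℝ (H (b i)) G = t * inner ℝ s (b i) := fun i => by
    rw [hH, ← hs, real_inner_smul_left]
  have e : ∀ i, inner ℝ (a₀ • H (b i) + (a₁ * inner ℝ s (b i)) • G)
        (Φ • H (b i) + inner ℝ G (b i) • W) =
      Φ * a₀ * ‖H (b i)‖ ^ 2 + a₀ * inner ℝ (inner ℝ G (b i) • H (b i)) W +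
        Φ * a₁ * t * (inner ℝ s (b i) * inner ℝ (b i) s) +
        a₁ * inner ℝ G W * (inner ℝ s (b i) * inner ℝ (b i) G) := by
    intro i
    simp only [inner_add_left, inner_add_right, real_inner_smul_left, real_inner_smul_right,
      real_inner_self_eq_norm_sq]
    rw [real_inner_comm (H (b i)) G, h1, real_inner_comm s (b i), real_inner_comm G (b i)]
    ring
  rw [Finset.sum_congr rfl fun i _ => e i, Finset.sum_add_distrib, Finset.sum_add_distrib,
    Finset.sum_add_distrib, ← Finset.mul_sum, ← Finset.mul_sum, ← Finset.mul_sum,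
    ← Finset.mul_sum, ← sum_inner, sum_inner_smul_apply, b.sum_inner_mul_inner,
    b.sum_inner_mul_inner, ← hs, real_inner_smul_left, real_inner_self_eq_norm_sq, sqFrobenius]
  ring

/-- In the same notation this is div(Φ∇u), the factor multiplying B in the lower-order term. -/
theorem sum_inner_basis_eq (H : E →L[ℝ] E) (G W : E) (Φ : ℝ) :
    ∑ i, inner ℝ (Φ • H (b i) + inner ℝ G (b i) • W) (b i) =
      Φ * ∑ i, inner ℝ (H (b i)) (b i) + inner ℝ G W := by
  simp only [inner_add_left, real_inner_smul_left]
  rw [Finset.sum_add_distrib, ← Finset.mul_sum, ← b.sum_inner_mul_inner G W]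
  congr 1
  exact Finset.sum_congr rfl fun i _ => by rw [real_inner_comm W]

theorem sq_trace_le (H : E →L[ℝ] E) :
    (∑ i, inner ℝ (H (b i)) (b i)) ^ 2 ≤ Fintype.card ι * sqFrobenius b H := by
  refine sq_sum_le_card_mul_sum_sq.trans ?_
  rw [Finset.card_univ]
  refine mul_le_mul_of_nonneg_left (Finset.sum_le_sum fun i _ => ?_) (by positivity)
  rw [← sq_abs]
  refine pow_le_pow_left₀ (abs_nonneg _) ?_ 2
  simpa using abs_real_inner_le_norm (H (b i)) (b i)

/-- For μ ≥ -1 the quadratic form |w|² + μ⟨n,w⟩² is nonnegative. Summing it over the vectors H b_i -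
⟨n,b_i⟩ H n, the columns of H composed with the projection orthogonal to n, gives exactly the
difference of the two sides. -/
theorem sq_norm_add_le_sqFrobenius {H : E →L[ℝ] E} (hH : ∀ v w, inner ℝ (H v) w = inner ℝ (H w) v)
    {n : E} (hn : ‖n‖ = 1) {μ : ℝ} (hμ : -1 ≤ μ) :
    ‖H n‖ ^ 2 + μ * inner ℝ n (H n) ^ 2 ≤ sqFrobenius b H + μ * ‖H n‖ ^ 2 := by
  set s := H n with hs
  set p := inner ℝ n s with hp
  have h1 : ∀ i, inner ℝ (H (b i)) n = inner ℝ s (b i) := fun i => hH _ _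
  have hq : ∀ w : E, 0 ≤ ‖w‖ ^ 2 + μ * inner ℝ n w ^ 2 := by
    intro w
    have : inner ℝ n w ^ 2 ≤ ‖w‖ ^ 2 := by
      rw [← sq_abs]
      refine pow_le_pow_left₀ (abs_nonneg _) ?_ 2
      simpa [hn] using abs_real_inner_le_norm n w
    nlinarith [sq_nonneg (inner ℝ n w)]
  have e : ∀ i, ‖H (b i) - inner ℝ n (b i) • s‖ ^ 2 +
        μ * inner ℝ n (H (b i) - inner ℝ n (b i) • s) ^ 2 =
      ‖H (b i)‖ ^ 2 - 2 * inner ℝ (inner ℝ n (b i) • H (b i)) s +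
        ‖s‖ ^ 2 * (inner ℝ n (b i) * inner ℝ (b i) n) +
        μ * (inner ℝ s (b i) * inner ℝ (b i) s) -
        2 * μ * p * (inner ℝ n (b i) * inner ℝ (b i) s) +
        μ * p ^ 2 * (inner ℝ n (b i) * inner ℝ (b i) n) := by
    intro i
    rw [norm_sub_sq_real, norm_smul, inner_sub_right, real_inner_smul_right, real_inner_smul_right,
      real_inner_smul_left, real_inner_comm (H (b i)) n, h1, real_inner_comm s (b i),
      real_inner_comm n (b i), mul_pow, Real.norm_eq_abs, sq_abs]
    ring
  have key := Finset.sum_nonneg fun i (_ : i ∈ Finset.univ) => hq (H (b i) - inner ℝ n (b i) • s)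
  rw [Finset.sum_congr rfl fun i _ => e i] at key
  simp only [Finset.sum_add_distrib, Finset.sum_sub_distrib, ← Finset.mul_sum] at key
  rw [← sum_inner, sum_inner_smul_apply, b.sum_inner_mul_inner, b.sum_inner_mul_inner,
    b.sum_inner_mul_inner, ← hs, real_inner_self_eq_norm_sq, real_inner_self_eq_norm_sq, hn,
    ← hp] at key
  rw [sqFrobenius]
  linarith

theorem sq_norm_apply_le_sqFrobenius {H : E →L[ℝ] E}
    (hH : ∀ v w, inner ℝ (H v) w = inner ℝ (H w) v) {n : E} (hn : ‖n‖ = 1) :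
    ‖H n‖ ^ 2 ≤ sqFrobenius b H := by
  simpa using sq_norm_add_le_sqFrobenius b hH hn (μ := 0) (by norm_num)

end LinearAlgebra

/-! ### The pointwise inequality behind the second-order estimate -/

set_option maxHeartbeats 1000000 in
/-- The lower bound behind the weighted second-order estimate, with the coefficients of the
quadratic form, the zero-order term and the cutoff as real parameters. -/
theorem second_order_pointwise_bound
    {m M τ Chat F L Q₁ Q₂ N' κ₀ κ M₁ : ℝ}
    (hτ : 0 < τ) (hτ1 : τ < 1) (hCh : 0 ≤ Chat) (hF : 0 ≤ F) (hN' : 1 ≤ N')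
    (hκ₀ : 0 < κ₀) (hκ₀1 : κ₀ ≤ 1) (hκ₀m : κ₀ ≤ 1 + m) (hκ : κ = (1 - τ) * κ₀ ^ 2)
    (hM₁ : M₁ = 1 + |m| + |M|)
    {μ a t k h h' B D S p q r tr z ζ f : ℝ}
    (hm : m ≤ μ) (hM : μ ≤ M) (ha : 0 ≤ a) (ht : 0 < t) (htL : t ≤ L) (hk : 0 ≤ k)
    (hh : 0 ≤ h) (hh1 : h ≤ 1) (hh' : 0 ≤ h') (hth' : t * h' ≤ 2)
    (hQ₁ : a ^ 2 * k * t ^ 2 ≤ Q₁) (hQ₂ : a * k * t ≤ Q₂)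
    (hB : 0 ≤ B) (hB' : B ≤ Chat * (t ^ 2 * a))
    (hSD : S ^ 2 ≤ D) (hS : 0 ≤ S) (hp : |p| ≤ S) (_hz : 0 ≤ z) (hq : |q| ≤ S * z) (hr : |r| ≤ z)
    (htr : tr ^ 2 ≤ N' * D) (hE : S ^ 2 + μ * p ^ 2 ≤ D + μ * S ^ 2) (hf : |f| ≤ F * t) :
    κ / 2 * (h * (a ^ 2 * k * D * ζ ^ 2)) -
      (Q₁ * (Chat ^ 2 * L ^ 2 / (2 * κ₀) + 4 * M₁ ^ 2 / κ + 2 * N' * Chat ^ 2 * L ^ 2 / κ +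
        2 * (1 + M₁) ^ 2 * Chat ^ 2 * L ^ 2 / κ + Chat * (L ^ 2 + 1)) + F * Q₂) *
        (ζ ^ 2 + z ^ 2) ≤
    a ^ 2 * k * (h * ζ ^ 2 * (D + μ * S ^ 2) +
        (t * h' - (1 - (1 - τ) * (1 + μ)) * h) * ζ ^ 2 * (S ^ 2 + μ * p ^ 2) +
        2 * h * ζ * t * (q + μ * p * r)) -
      B * (a * k) * (h * ζ ^ 2 * tr +
        (t * h' - (1 - (1 - τ) * (1 + μ)) * h) * ζ ^ 2 * p + 2 * h * ζ * t * r) -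
      h * (a * k) * ζ ^ 2 * f := by
  have hκ0 : 0 < κ := by rw [hκ]; have := sub_pos.2 hτ1; positivity
  -- In the application t = |∇u|, a = A(t), k = (tA)^(-τ), μ = tA'/A, h is the cutoff at t, n =
  -- ∇u/|∇u|, D = |D²u|², S = |∇|∇u||, p = ⟨n, ∇|∇u|⟩, q = ⟨∇|∇u|, ∇ζ⟩, r = ⟨n, ∇ζ⟩, z = |∇ζ|, tr =
  -- Δu and f = ⟨∇f, ∇u⟩.
  set w := a ^ 2 * k with hw
  have hw0 : 0 ≤ w := by positivity
  set β := B * (a * k) with hβ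
  have hβ0 : 0 ≤ β := by positivity
  have hβ1 : β ≤ Chat * t ^ 2 * w := by
    have := mul_le_mul_of_nonneg_right hB' (by positivity : 0 ≤ a * k)
    rw [hβ, hw]; linarith only [this]
  have hL : 0 < L := ht.trans_le htL
  have ht2 : t ^ 2 ≤ L ^ 2 := pow_le_pow_left₀ ht.le htL 2
  have hQ0 : 0 ≤ Q₁ := le_trans (by positivity) hQ₁
  have hQ20 : 0 ≤ Q₂ := le_trans (by positivity) hQ₂
  have hp2 : p ^ 2 ≤ S ^ 2 := by rw [← sq_abs p]; exact pow_le_pow_left₀ (abs_nonneg _) hp 2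
  have hζ0 : 0 ≤ ζ ^ 2 := sq_nonneg ζ
  have hμM₁ : |μ| ≤ M₁ - 1 := by
    rw [hM₁, abs_le]
    constructor <;> linarith only [hm, hM, neg_abs_le m, le_abs_self M, abs_nonneg m, abs_nonneg M]
  have hM₁1 : 1 ≤ M₁ := by linarith only [hμM₁, abs_nonneg μ]
  set bb := 1 - (1 - τ) * (1 + μ) with hbb
  have hbbM : |bb| ≤ 1 + M₁ := by
    rw [hbb, abs_le]
    have := abs_le.1 hμM₁
    have h1 : 0 ≤ (1 - τ) * (1 + μ) := mul_nonneg (by linarith only [hτ1]) (by linarith only [hκ₀, hκ₀m, hm])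
    have h2 : (1 - τ) * (1 + μ) ≤ 1 + μ := mul_le_of_le_one_left (by linarith only [hκ₀, hκ₀m, hm]) (by linarith only [hτ])
    constructor <;> linarith only [this.1, this.2, h1, h2, hM₁1]
  have hD0 : 0 ≤ D := (sq_nonneg S).trans hSD
  set Ee := S ^ 2 + μ * p ^ 2 with hEe
  have hES : κ₀ * S ^ 2 ≤ Ee := by
    rcases le_total 0 μ with h0 | h0
    · linarith only [mul_nonneg h0 (sq_nonneg p), hEe,
        mul_nonneg (sub_nonneg.2 hκ₀1) (sq_nonneg S)]
    · linarith only [mul_nonneg (neg_nonneg.2 h0) (sub_nonneg.2 hp2), hEe,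
        mul_nonneg (sub_nonneg.2 (hκ₀m.trans (add_le_add_right hm 1))) (sq_nonneg S)]
  have hDμ : κ₀ * D ≤ D + μ * S ^ 2 := by
    rcases le_total 0 μ with h0 | h0
    · linarith only [mul_nonneg h0 (sq_nonneg S), mul_nonneg (sub_nonneg.2 hκ₀1) hD0]
    · linarith only [mul_nonneg (neg_nonneg.2 h0) (sub_nonneg.2 hSD),
        mul_nonneg (sub_nonneg.2 (hκ₀m.trans (add_le_add_right hm 1))) hD0]
  have hE0 : 0 ≤ Ee := le_trans (by positivity) hES
  -- coercivity
  have J1 : κ * D ≤ D + μ * S ^ 2 - bb * Ee := by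
    set lam := (1 - τ) * (1 + μ) with hlam
    have hlam1 : (1 - τ) * κ₀ ≤ lam := mul_le_mul_of_nonneg_left (by linarith only [hκ₀m, hm])
      (by linarith only [hτ1])
    have hk1 : (1 - τ) * κ₀ ≤ 1 := mul_le_one₀ (by linarith only [hτ]) hκ₀.le hκ₀1
    have hk0 : 0 ≤ (1 - τ) * κ₀ := mul_nonneg (by linarith only [hτ1]) hκ₀.le
    -- The quantity to bound is (D + μS² - E) + λE with both summands nonnegative. As (1-τ)κ₀ is at
    -- most 1 and at most λ, the sum is at least (1-τ)κ₀ (D + μS²), and one more factor κ₀ reaches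
    -- D.
    have e1 : (1 - τ) * κ₀ * Ee ≤ lam * Ee := mul_le_mul_of_nonneg_right hlam1 hE0
    have e2 : (1 - τ) * κ₀ * (D + μ * S ^ 2 - Ee) ≤ D + μ * S ^ 2 - Ee :=
      mul_le_of_le_one_left (sub_nonneg.2 hE) hk1
    have e3 : (1 - τ) * κ₀ * (κ₀ * D) ≤ (1 - τ) * κ₀ * (D + μ * S ^ 2) :=
      mul_le_mul_of_nonneg_left hDμ hk0
    rw [hκ, hbb]
    linarith only [e1, e2, e3]
  have I1 : w * (h * ζ ^ 2) * (κ * D) ≤ w * (h * ζ ^ 2) * (D + μ * S ^ 2 - bb * Ee) :=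
    mul_le_mul_of_nonneg_left J1 (by positivity)
  -- Young's inequality for the derivative of the cutoff
  have I2 : -(Q₁ * (Chat ^ 2 * L ^ 2 / (2 * κ₀)) * ζ ^ 2) ≤
      w * (t * h') * ζ ^ 2 * Ee - β * (t * h') * ζ ^ 2 * p := by
    have hth0 : 0 ≤ t * h' := by positivity
    -- The derivative h' is not controlled by h, so the coercive term, which carries h, cannot
    -- absorb this part of B. The nonnegative term with E carries the same factor t h' and absorbs
    -- it instead.
    have y1 : Chat * t ^ 2 * S ≤ κ₀ * S ^ 2 + (Chat * t ^ 2) ^ 2 / (4 * κ₀) := by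
      have : 0 ≤ (2 * κ₀ * S - Chat * t ^ 2) ^ 2 / (4 * κ₀) := by positivity
      have e : (2 * κ₀ * S - Chat * t ^ 2) ^ 2 / (4 * κ₀) =
        κ₀ * S ^ 2 - Chat * t ^ 2 * S + (Chat * t ^ 2) ^ 2 / (4 * κ₀) := by field_simp; ring
      linarith only [this, e]
    have y2 : β * p ≤ w * (Chat * t ^ 2 * S) := by
      calc β * p ≤ β * S := mul_le_mul_of_nonneg_left ((le_abs_self p).trans hp) hβ0
        _ ≤ Chat * t ^ 2 * w * S := mul_le_mul_of_nonneg_right hβ1 hS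
        _ = _ := by ring
    have y3 : -(w * ((Chat * t ^ 2) ^ 2 / (4 * κ₀))) ≤ w * Ee - β * p := by
      linarith only [mul_le_mul_of_nonneg_left y1 hw0, mul_le_mul_of_nonneg_left hES hw0, y2]
    have y4 : w * ((Chat * t ^ 2) ^ 2 / (4 * κ₀)) ≤ Q₁ * (Chat ^ 2 * L ^ 2 / (4 * κ₀)) := by
      calc w * ((Chat * t ^ 2) ^ 2 / (4 * κ₀)) = (w * t ^ 2) * (Chat ^ 2 * t ^ 2 / (4 * κ₀)) := by
            ring
        _ ≤ Q₁ * (Chat ^ 2 * L ^ 2 / (4 * κ₀)) := by gcongr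
    have y5 : t * h' * ζ ^ 2 * (w * ((Chat * t ^ 2) ^ 2 / (4 * κ₀))) ≤
        2 * ζ ^ 2 * (Q₁ * (Chat ^ 2 * L ^ 2 / (4 * κ₀))) := by gcongr
    have y6 := mul_le_mul_of_nonneg_left y3 (by positivity : 0 ≤ t * h' * ζ ^ 2)
    have e : 2 * ζ ^ 2 * (Q₁ * (Chat ^ 2 * L ^ 2 / (4 * κ₀))) =
      Q₁ * (Chat ^ 2 * L ^ 2 / (2 * κ₀)) * ζ ^ 2 := by field_simp; ring
    linarith only [y5, y6, e]
  -- The next three bounds spend κ/4, κ/8 and κ/8 of the coercive constant κ; the remaining κ/2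
  -- appears in the conclusion.
  have I3 : -(w * h * ζ ^ 2 * (κ / 4 * D)) - Q₁ * (4 * M₁ ^ 2 / κ) * z ^ 2 ≤
      w * (2 * h * ζ * t * (q + μ * p * r)) := by
    have x1 : |q + μ * p * r| ≤ M₁ * (S * z) := by
      refine (abs_add_le _ _).trans ?_
      rw [abs_mul, abs_mul]
      have : |μ| * |p| * |r| ≤ (M₁ - 1) * S * z := by gcongr
      linarith only [this, hq]
    have x2 : -(2 * |ζ| * t * (M₁ * (S * z))) ≤ 2 * ζ * t * (q + μ * p * r) := by
      have : |2 * ζ * t * (q + μ * p * r)| ≤ 2 * |ζ| * t * (M₁ * (S * z)) := by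
        rw [abs_mul, abs_mul, abs_mul, abs_two, abs_of_pos ht]
        gcongr
      linarith only [this, neg_abs_le (2 * ζ * t * (q + μ * p * r))]
    have x3 : 2 * |ζ| * t * (M₁ * (S * z)) ≤ ζ ^ 2 * (κ / 4 * S ^ 2) +
        t ^ 2 * (4 * M₁ ^ 2 / κ) * z ^ 2 := by
      have : 0 ≤ (κ * |ζ| * S - 4 * t * M₁ * z) ^ 2 / (4 * κ) := by positivity
      have e : (κ * |ζ| * S - 4 * t * M₁ * z) ^ 2 / (4 * κ) = |ζ| ^ 2 * (κ / 4 * S ^ 2) +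
        t ^ 2 * (4 * M₁ ^ 2 / κ) * z ^ 2 - 2 * |ζ| * t * (M₁ * (S * z)) := by field_simp; ring
      rw [sq_abs] at e
      linarith only [e, this]
    have x4 : ζ ^ 2 * (κ / 4 * S ^ 2) ≤ ζ ^ 2 * (κ / 4 * D) := by gcongr
    have x5 : h * (w * t ^ 2 * (4 * M₁ ^ 2 / κ) * z ^ 2) ≤ 1 * (Q₁ * (4 * M₁ ^ 2 / κ) * z ^ 2) := by
      gcongr
    have x6 := mul_le_mul_of_nonneg_left (x2.trans' (neg_le_neg (x3.trans
      (add_le_add_left x4 _)))) (by positivity : 0 ≤ w * h)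
    linarith only [x5, x6]
  have I4 : β * (h * ζ ^ 2 * tr) ≤ w * h * ζ ^ 2 * (κ / 8 * D) +
      Q₁ * (2 * N' * Chat ^ 2 * L ^ 2 / κ) * ζ ^ 2 := by
    have x1 : Chat * t ^ 2 * |tr| ≤ κ / 8 * D + t ^ 2 * (2 * N' * Chat ^ 2 * L ^ 2 / κ) := by
      have : 0 ≤ (κ * |tr| - 4 * N' * (Chat * t ^ 2)) ^ 2 / (8 * N' * κ) := by positivity
      have e : (κ * |tr| - 4 * N' * (Chat * t ^ 2)) ^ 2 / (8 * N' * κ) =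
        κ / 8 * (|tr| ^ 2 / N') + t ^ 2 * (2 * N' * Chat ^ 2 * t ^ 2 / κ) - Chat * t ^ 2 * |tr| := by
        field_simp; ring
      have h1 : |tr| ^ 2 / N' ≤ D := by
        rw [div_le_iff₀ (by linarith only [hN']), sq_abs]; linarith only [htr]
      have h2 : κ / 8 * (|tr| ^ 2 / N') ≤ κ / 8 * D := by gcongr
      have h3 : t ^ 2 * (2 * N' * Chat ^ 2 * t ^ 2 / κ) ≤
        t ^ 2 * (2 * N' * Chat ^ 2 * L ^ 2 / κ) := by gcongr
      linarith only [this, e, h2, h3]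
    have x2 : β * (h * ζ ^ 2 * tr) ≤ w * (h * ζ ^ 2) * (Chat * t ^ 2 * |tr|) := by
      calc β * (h * ζ ^ 2 * tr) ≤ β * (h * ζ ^ 2 * |tr|) := by gcongr; exact le_abs_self _
        _ ≤ Chat * t ^ 2 * w * (h * ζ ^ 2 * |tr|) := by gcongr
        _ = _ := by ring
    have x3 := mul_le_mul_of_nonneg_left x1 (by positivity : 0 ≤ w * (h * ζ ^ 2))
    have x5 : h * (w * t ^ 2 * (2 * N' * Chat ^ 2 * L ^ 2 / κ) * ζ ^ 2) ≤
      1 * (Q₁ * (2 * N' * Chat ^ 2 * L ^ 2 / κ) * ζ ^ 2) := by gcongr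
    linarith only [x2, x3, x5]
  have I5 : β * (-bb * h * ζ ^ 2 * p) ≤ w * h * ζ ^ 2 * (κ / 8 * D) +
      Q₁ * (2 * (1 + M₁) ^ 2 * Chat ^ 2 * L ^ 2 / κ) * ζ ^ 2 := by
    have x1 : Chat * t ^ 2 * ((1 + M₁) * S) ≤ κ / 8 * D +
        t ^ 2 * (2 * (1 + M₁) ^ 2 * Chat ^ 2 * L ^ 2 / κ) := by
      have : 0 ≤ (κ * S - 4 * (1 + M₁) * (Chat * t ^ 2)) ^ 2 / (8 * κ) := by positivity
      have e : (κ * S - 4 * (1 + M₁) * (Chat * t ^ 2)) ^ 2 / (8 * κ) =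
        κ / 8 * S ^ 2 + t ^ 2 * (2 * (1 + M₁) ^ 2 * Chat ^ 2 * t ^ 2 / κ) -
          Chat * t ^ 2 * ((1 + M₁) * S) := by
        field_simp; ring
      have h2 : κ / 8 * S ^ 2 ≤ κ / 8 * D := by gcongr
      have h3 : t ^ 2 * (2 * (1 + M₁) ^ 2 * Chat ^ 2 * t ^ 2 / κ) ≤
        t ^ 2 * (2 * (1 + M₁) ^ 2 * Chat ^ 2 * L ^ 2 / κ) := by gcongr
      linarith only [this, e, h2, h3]
    have x0 : -bb * p ≤ (1 + M₁) * S := by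
      refine (le_abs_self _).trans ?_
      rw [abs_mul, abs_neg]
      gcongr
    have x2 : β * (-bb * h * ζ ^ 2 * p) ≤ w * (h * ζ ^ 2) * (Chat * t ^ 2 * ((1 + M₁) * S)) := by
      calc β * (-bb * h * ζ ^ 2 * p) = β * (h * ζ ^ 2 * (-bb * p)) := by ring
        _ ≤ β * (h * ζ ^ 2 * ((1 + M₁) * S)) := by gcongr
        _ ≤ Chat * t ^ 2 * w * (h * ζ ^ 2 * ((1 + M₁) * S)) := by gcongr
        _ = _ := by ring
    have x3 := mul_le_mul_of_nonneg_left x1 (by positivity : 0 ≤ w * (h * ζ ^ 2))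
    have x5 : h * (w * t ^ 2 * (2 * (1 + M₁) ^ 2 * Chat ^ 2 * L ^ 2 / κ) * ζ ^ 2) ≤
      1 * (Q₁ * (2 * (1 + M₁) ^ 2 * Chat ^ 2 * L ^ 2 / κ) * ζ ^ 2) := by gcongr
    linarith only [x2, x3, x5]
  have I6 : β * (2 * h * ζ * t * r) ≤ Q₁ * (Chat * (L ^ 2 + 1)) * (ζ ^ 2 + z ^ 2) := by
    have x0 : 2 * ζ * t * r ≤ (L ^ 2 + 1) * (ζ ^ 2 + z ^ 2) := by
      have h1 : 2 * (t * ζ) * r ≤ (t * ζ) ^ 2 + r ^ 2 := two_mul_le_add_sq _ _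
      have h2 : r ^ 2 ≤ z ^ 2 := by rw [← sq_abs r]; exact pow_le_pow_left₀ (abs_nonneg _) hr 2
      have h3 : t ^ 2 * ζ ^ 2 ≤ L ^ 2 * ζ ^ 2 := by gcongr
      linarith only [h1, h2, h3, mul_nonneg (sq_nonneg L) (sq_nonneg z), sq_nonneg ζ]
    calc β * (2 * h * ζ * t * r) = β * (h * (2 * ζ * t * r)) := by ring
      _ ≤ β * (h * ((L ^ 2 + 1) * (ζ ^ 2 + z ^ 2))) := by gcongr
      _ ≤ Chat * t ^ 2 * w * (1 * ((L ^ 2 + 1) * (ζ ^ 2 + z ^ 2))) := by gcongr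
      _ = w * t ^ 2 * (Chat * (L ^ 2 + 1)) * (ζ ^ 2 + z ^ 2) := by ring
      _ ≤ _ := by gcongr
  have I7 : h * (a * k) * ζ ^ 2 * f ≤ F * Q₂ * ζ ^ 2 := by
    calc h * (a * k) * ζ ^ 2 * f ≤ h * (a * k) * ζ ^ 2 * (F * t) := by
          gcongr; exact (le_abs_self f).trans hf
      _ ≤ 1 * (a * k) * ζ ^ 2 * (F * t) := by gcongr
      _ = F * (a * k * t) * ζ ^ 2 := by ring
      _ ≤ _ := by gcongr
  have r1 : 0 ≤ Q₁ * (Chat ^ 2 * L ^ 2 / (2 * κ₀)) * z ^ 2 := by positivity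
  have r2 : 0 ≤ Q₁ * (4 * M₁ ^ 2 / κ) * ζ ^ 2 := by positivity
  have r3 : 0 ≤ Q₁ * (2 * N' * Chat ^ 2 * L ^ 2 / κ) * z ^ 2 := by positivity
  have r4 : 0 ≤ Q₁ * (2 * (1 + M₁) ^ 2 * Chat ^ 2 * L ^ 2 / κ) * z ^ 2 := by positivity
  have r5 : 0 ≤ F * Q₂ * z ^ 2 := by positivity
  linarith only [I1, I2, I3, I4, I5, I6, I7, r1, r2, r3, r4, r5]

/-! ### Gradient calculus and integrability on compact supports -/

section GradientCalculus

variable {N : ℕ} {f g : RSpace N → ℝ} {f' g' x : RSpace N}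

theorem HasGradientAt.real_mul (hf : HasGradientAt f f' x) (hg : HasGradientAt g g' x) :
    HasGradientAt (fun y => f y * g y) (f x • g' + g x • f') x := by
  have := hf.hasFDerivAt.mul hg.hasFDerivAt
  rw [hasGradientAt_iff_hasFDerivAt]
  refine this.congr_fderiv ?_
  rw [map_add, map_smul, map_smul]

theorem HasDerivAt.comp_hasGradientAt {φ : ℝ → ℝ} {φ' : ℝ} (hφ : HasDerivAt φ φ' (f x))
    (hf : HasGradientAt f f' x) : HasGradientAt (fun y => φ (f y)) (φ' • f') x := by
  have := hφ.comp_hasFDerivAt x hf.hasFDerivAt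
  rw [hasGradientAt_iff_hasFDerivAt]
  refine this.congr_fderiv ?_
  rw [map_smul]

theorem hasGradientAt_of_contDiff (hf : ContDiff ℝ 1 f) (x : RSpace N) :
    HasGradientAt f (gradient f x) x :=
  (hf.differentiable one_ne_zero x).hasGradientAt

end GradientCalculus

section Integrability

variable {N : ℕ}

theorem integrable_of_continuousOn_compact {S : Set (RSpace N)} (hS : IsCompact S)
    {P : RSpace N → ℝ} (hP : ContinuousOn P S) (h0 : ∀ x, x ∉ S → P x = 0) : Integrable P := by
  refine (integrableOn_iff_integrable_of_support_subset fun x hx => ?_).1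
    (hP.integrableOn_compact hS)
  by_contra h
  exact hx (h0 x h)

theorem integrable_weak_pairing {S : Set (RSpace N)}
    (hS : IsCompact S) {X : RSpace N → RSpace N} {Y : RSpace N → ℝ}
    (hX : IntegrableOn X S) (hY : IntegrableOn Y S) {ψ : RSpace N → ℝ} (hψ : ContDiff ℝ 1 ψ)
    (hs : tsupport ψ ⊆ S) :
    Integrable (fun x => inner ℝ (X x) (gradient ψ x) + Y x * ψ x) := by
  refine (integrableOn_iff_integrable_of_support_subset fun x hx => ?_).1
    (integrableOn_weak_pairing hS hX hY hψ)
  by_contra h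
  refine hx ?_
  dsimp only
  rw [gradient_eq_zero_of_notMem_tsupport fun h' => h (hs h'),
    image_eq_zero_of_notMem_tsupport fun h' => h (hs h'), inner_zero_right, mul_zero, add_zero]

theorem contDiff_of_contDiffOn_of_tsupport_subset {U : Set (RSpace N)} (hU : IsOpen U)
    {P : RSpace N → ℝ} {n : ℕ∞ω} (hP : ContDiffOn ℝ n P U) (hs : tsupport P ⊆ U) :
    ContDiff ℝ n P :=
  contDiff_iff_contDiffAt.2 fun x => by
    by_cases hx : x ∈ tsupport P
    · exact hP.contDiffAt (hU.mem_nhds (hs hx))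
    · exact contDiffAt_const.congr_of_eventuallyEq (notMem_tsupport_iff_eventuallyEq.1 hx)

end Integrability

theorem IsTestFunction.contDiff_one {N : ℕ} {Ω : Set (RSpace N)} {ψ : RSpace N → ℝ}
    (h : IsTestFunction Ω ψ) : ContDiff ℝ 1 ψ := h.1.of_le (by exact_mod_cast le_top)

theorem IsTestFunction.mono {N : ℕ} {Ω Ω' : Set (RSpace N)} {ψ : RSpace N → ℝ}
    (h : IsTestFunction Ω ψ) (hs : Ω ⊆ Ω') : IsTestFunction Ω' ψ := ⟨h.1, h.2.1, h.2.2.trans hs⟩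

theorem IsTestFunction.fderiv_apply {N : ℕ} {Ω : Set (RSpace N)} {ψ : RSpace N → ℝ}
    (h : IsTestFunction Ω ψ) (v : RSpace N) : IsTestFunction Ω (fun x => fderiv ℝ ψ x v) := by
  refine ⟨(h.1.fderiv_right (m := ∞) (by simp)).clm_apply contDiff_const,
    h.2.1.fderiv_apply ℝ v, ?_⟩
  exact (tsupport_fderiv_apply_subset ℝ v).trans h.2.2

theorem inner_fderiv_gradient {N : ℕ} {ψ : RSpace N → ℝ} {x : RSpace N}
    (h : ContDiffAt ℝ 2 ψ x) (v w : RSpace N) :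
    inner ℝ (fderiv ℝ (gradient ψ) x v) w = fderiv ℝ (fderiv ℝ ψ) x v w := by
  have hc : ContDiffAt ℝ 1 (fderiv ℝ ψ) x := h.fderiv_right (by norm_num)
  have hd : DifferentiableAt ℝ (fderiv ℝ ψ) x := hc.differentiableAt one_ne_zero
  have hG : ContDiffAt ℝ 1 (gradient ψ) x :=
    (LinearIsometryEquiv.contDiff _).contDiffAt.comp x hc
  have h1 := fderiv_inner_apply ℝ (hG.differentiableAt one_ne_zero) (differentiableAt_const w) v
  simp only [fderiv_fun_const, Pi.zero_apply, zero_apply, inner_zero_right, zero_add,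
    inner_gradient_left] at h1
  rw [← h1, fderiv_clm_apply hd (differentiableAt_const w)]
  simp

theorem gradient_fderiv_apply {N : ℕ} {ψ : RSpace N → ℝ} (h : ContDiff ℝ 2 ψ)
    (v x : RSpace N) :
    gradient (fun x => fderiv ℝ ψ x v) x = fderiv ℝ (gradient ψ) x v := by
  have hd : DifferentiableAt ℝ (fderiv ℝ ψ) x :=
    (h.fderiv_right (m := 1) (by norm_num)).differentiable one_ne_zero x
  refine ext_inner_right ℝ fun w => ?_
  rw [inner_gradient_left, inner_fderiv_gradient h.contDiffAt,
    h.contDiffAt.isSymmSndFDerivAt (by simp) v w, fderiv_clm_apply hd (differentiableAt_const v)]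
  simp

/-! ### The flux and the differentiated equation -/

/-- The field `A(|∇u|)∇u`. -/
noncomputable def flux {N : ℕ} (A : ℝ → ℝ) (u : RSpace N → ℝ) (x : RSpace N) : RSpace N :=
  A ‖gradient u x‖ • gradient u x

/-- The gradient of `|∇u|` off the critical set. -/
noncomputable def gradNormGradient {N : ℕ} (u : RSpace N → ℝ) (x : RSpace N) : RSpace N :=
  ‖gradient u x‖⁻¹ • fderiv ℝ (gradient u) x (gradient u x)

namespace IsSignedSolution

variable {N : ℕ} {x₀ : RSpace N} {ρ m M K θ Chat c F : ℝ} {Ω : Set (RSpace N)} {A B : ℝ → ℝ}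
  {f u : RSpace N → ℝ}

theorem continuousOn_gradient (h : IsSignedSolution x₀ ρ m M K θ Chat c F Ω A B f u) :
    ContinuousOn (gradient u) Ω :=
  (LinearIsometryEquiv.continuous _).comp_continuousOn
    (h.cOneHolder.1.continuousOn_fderiv_of_isOpen h.isOpen le_rfl)

theorem isOpen_regular (h : IsSignedSolution x₀ ρ m M K θ Chat c F Ω A B f u) :
    IsOpen (Ω \ criticalSet u) := by
  have := h.continuousOn_gradient.isOpen_inter_preimage h.isOpen (isOpen_compl_singleton (x := 0))
  rwa [show Ω \ criticalSet u = Ω ∩ gradient u ⁻¹' {0}ᶜ from rfl]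

theorem contDiffOn_gradient (h : IsSignedSolution x₀ ρ m M K θ Chat c F Ω A B f u) :
    ContDiffOn ℝ 1 (gradient u) (Ω \ criticalSet u) :=
  (LinearIsometryEquiv.contDiff _).comp_contDiffOn
    (h.cTwo.fderiv_of_isOpen h.isOpen_regular (by norm_num))

theorem norm_gradient_pos {x : RSpace N} (hx : x ∈ Ω \ criticalSet u) :
    0 < ‖gradient u x‖ := norm_pos_iff.2 fun h0 => hx.2 h0

theorem hasFDerivAt_gradient (h : IsSignedSolution x₀ ρ m M K θ Chat c F Ω A B f u)
    {x : RSpace N} (hx : x ∈ Ω \ criticalSet u) :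
    HasFDerivAt (gradient u) (fderiv ℝ (gradient u) x) x :=
  ((h.contDiffOn_gradient.differentiableOn one_ne_zero).differentiableAt
    (h.isOpen_regular.mem_nhds hx)).hasFDerivAt

theorem continuousOn_hessian (h : IsSignedSolution x₀ ρ m M K θ Chat c F Ω A B f u) :
    ContinuousOn (fderiv ℝ (gradient u)) (Ω \ criticalSet u) :=
  h.contDiffOn_gradient.continuousOn_fderiv_of_isOpen h.isOpen_regular le_rfl

theorem hessian_symm (h : IsSignedSolution x₀ ρ m M K θ Chat c F Ω A B f u)
    {x : RSpace N} (hx : x ∈ Ω \ criticalSet u) (v w : RSpace N) :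
    inner ℝ (fderiv ℝ (gradient u) x v) w = inner ℝ (fderiv ℝ (gradient u) x w) v := by
  have hcd : ContDiffAt ℝ 2 u x := h.cTwo.contDiffAt (h.isOpen_regular.mem_nhds hx)
  rw [inner_fderiv_gradient hcd, inner_fderiv_gradient hcd]
  exact hcd.isSymmSndFDerivAt (by simp) v w

theorem hasGradientAt_norm (h : IsSignedSolution x₀ ρ m M K θ Chat c F Ω A B f u)
    {x : RSpace N} (hx : x ∈ Ω \ criticalSet u) :
    HasGradientAt (fun y => ‖gradient u y‖) (gradNormGradient u x) x := by
  have hpos := norm_gradient_pos hx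
  have h1 := (h.hasFDerivAt_gradient hx).norm_sq.sqrt (by positivity)
  simp only [Real.sqrt_sq (norm_nonneg _)] at h1
  rw [hasGradientAt_iff_hasFDerivAt]
  refine h1.congr_fderiv ?_
  ext v
  rw [gradNormGradient]
  simp only [smul_apply, ContinuousLinearMap.comp_apply, innerSL_apply_apply,
    InnerProductSpace.toDual_apply_apply, real_inner_smul_left, smul_eq_mul, nsmul_eq_mul]
  rw [h.hessian_symm hx (gradient u x) v, real_inner_comm (gradient u x)]
  push_cast
  field_simp

theorem norm_smul_gradNormGradient {x : RSpace N} (hx : x ∈ Ω \ criticalSet u) :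
    ‖gradient u x‖ • gradNormGradient u x = fderiv ℝ (gradient u) x (gradient u x) := by
  rw [gradNormGradient, smul_smul, mul_inv_cancel₀ (norm_gradient_pos hx).ne', one_smul]

theorem contDiffOn_norm (h : IsSignedSolution x₀ ρ m M K θ Chat c F Ω A B f u) :
    ContDiffOn ℝ 1 (fun y => ‖gradient u y‖) (Ω \ criticalSet u) :=
  h.contDiffOn_gradient.norm ℝ fun _ hx => norm_pos_iff.1 (norm_gradient_pos hx)

theorem contDiffOn_comp_norm (h : IsSignedSolution x₀ ρ m M K θ Chat c F Ω A B f u)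
    {φ : ℝ → ℝ} (hφ : ContDiffOn ℝ 1 φ (Ioi 0)) :
    ContDiffOn ℝ 1 (fun y => φ ‖gradient u y‖) (Ω \ criticalSet u) :=
  hφ.comp h.contDiffOn_norm fun _ hx => norm_gradient_pos hx

theorem contDiffOn_flux (h : IsSignedSolution x₀ ρ m M K θ Chat c F Ω A B f u) :
    ContDiffOn ℝ 1 (flux A u) (Ω \ criticalSet u) :=
  (h.contDiffOn_comp_norm h.admissibleA.contDiffOn).smul h.contDiffOn_gradient

theorem fderiv_flux (h : IsSignedSolution x₀ ρ m M K θ Chat c F Ω A B f u)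
    {x : RSpace N} (hx : x ∈ Ω \ criticalSet u) (v : RSpace N) :
    fderiv ℝ (flux A u) x v = A ‖gradient u x‖ • fderiv ℝ (gradient u) x v +
      (deriv A ‖gradient u x‖ * inner ℝ (gradNormGradient u x) v) • gradient u x := by
  have h1 := HasDerivAt.comp_hasGradientAt (f := fun y => ‖gradient u y‖)
    (h.admissibleA.hasDerivAt (norm_gradient_pos hx)) (h.hasGradientAt_norm hx)
  have h2 := h1.hasFDerivAt.smul (h.hasFDerivAt_gradient hx)
  have h3 : fderiv ℝ (flux A u) x = _ := h2.fderiv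
  rw [h3]
  simp

theorem continuousOn_lowerOrder (h : IsSignedSolution x₀ ρ m M K θ Chat c F Ω A B f u) :
    ContinuousOn (fun x => B ‖gradient u x‖) Ω :=
  h.admissibleB.contDiffOn.continuousOn.comp h.continuousOn_gradient.norm
    fun _ _ => norm_nonneg _

theorem norm_flux (h : IsSignedSolution x₀ ρ m M K θ Chat c F Ω A B f u) (x : RSpace N) :
    ‖flux A u x‖ = ‖gradient u x‖ * A ‖gradient u x‖ := by
  rw [flux, norm_smul, mul_comm]
  rcases (norm_nonneg (gradient u x)).eq_or_lt with h0 | h0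
  · rw [← h0]; simp
  · rw [Real.norm_of_nonneg (h.admissibleA.pos _ h0).le]

/-- At critical points this rests on t A(t) → 0 as t → 0; A itself may be unbounded near 0, and its
value at 0 is irrelevant. -/
theorem continuousOn_flux (h : IsSignedSolution x₀ ρ m M K θ Chat c F Ω A B f u) :
    ContinuousOn (flux A u) Ω := by
  intro x hx
  by_cases hc : x ∈ criticalSet u
  · refine ContinuousAt.continuousWithinAt ?_
    have hx0 : flux A u x = 0 := by
      have : gradient u x = 0 := hc
      rw [flux, this, smul_zero]
    rw [ContinuousAt, hx0, Metric.tendsto_nhds]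
    intro ε hε
    obtain ⟨δ, hδ, hlt⟩ := h.admissibleA.exists_mul_lt hε
    have hG : ContinuousAt (gradient u) x := h.continuousOn_gradient.continuousAt
      (h.isOpen.mem_nhds hx)
    have hG0 : ‖gradient u x‖ < δ := by
      have : gradient u x = 0 := hc
      rw [this, norm_zero]; exact hδ
    filter_upwards [hG.norm.eventually (gt_mem_nhds hG0)] with y hy
    rw [dist_zero_right, h.norm_flux]
    rcases (norm_nonneg (gradient u y)).eq_or_lt with h0 | h0
    · rw [← h0, zero_mul]; exact hε
    · exact hlt _ h0 hy.le
  · exact (h.contDiffOn_flux.continuousOn.continuousAt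
      (h.isOpen_regular.mem_nhds ⟨hx, hc⟩)).continuousWithinAt

theorem integrableOn_source (h : IsSignedSolution x₀ ρ m M K θ Chat c F Ω A B f u)
    {S : Set (RSpace N)} (hS : IsCompact S) (hSΩ : S ⊆ Ω) : IntegrableOn f S := by
  have : IsFiniteMeasure (volume.restrict S) := ⟨by
    rw [Measure.restrict_apply_univ]; exact hS.measure_lt_top⟩
  exact ((h.memSobolev.1.mono_measure (Measure.restrict_mono hSΩ le_rfl)).integrable le_top)

/-- The weak formulation holds for `C^1` test functions. -/
theorem weak_equation (h : IsSignedSolution x₀ ρ m M K θ Chat c F Ω A B f u)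
    {ψ : RSpace N → ℝ} (hψ : ContDiff ℝ 1 ψ) (hc : HasCompactSupport ψ) (hs : tsupport ψ ⊆ Ω) :
    ∫ x in Ω, (inner ℝ (flux A u x) (gradient ψ x) + (B ‖gradient u x‖ - f x) * ψ x) = 0 := by
  have hX : ∀ S, IsCompact S → S ⊆ Ω → IntegrableOn (flux A u) S := fun S hS hSΩ =>
    (h.continuousOn_flux.mono hSΩ).integrableOn_compact hS
  have hBi : ∀ S, IsCompact S → S ⊆ Ω → IntegrableOn (fun x => B ‖gradient u x‖) S :=
    fun S hS hSΩ => (h.continuousOn_lowerOrder.mono hSΩ).integrableOn_compact hS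
  refine weak_identity_of_contDiff_one (Y := fun x => B ‖gradient u x‖ - f x)
    h.isOpen.measurableSet h.isOpen subset_rfl hX
    (fun S hS hSΩ => (hBi S hS hSΩ).sub (h.integrableOn_source hS hSΩ)) (fun φ hφ => ?_) hψ hc hs
  have hw := h.weakSolution φ hφ
  have hK : IsCompact (tsupport φ) := hφ.2.1
  have hz : ∀ x, x ∉ tsupport φ → φ x = 0 := fun x hx => image_eq_zero_of_notMem_tsupport hx
  have hzg : ∀ x, x ∉ tsupport φ → gradient φ x = 0 :=
    fun x hx => gradient_eq_zero_of_notMem_tsupport hx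
  have i1 := integrableOn_weak_pairing hK (hX _ hK hφ.2.2)
    (Y := fun _ => 0) integrableOn_zero hφ.contDiff_one
  have i2 := integrableOn_weak_pairing hK (X := fun _ => 0) integrableOn_zero
    (hBi _ hK hφ.2.2) hφ.contDiff_one
  have i3 := integrableOn_weak_pairing hK (X := fun _ => 0) integrableOn_zero
    (h.integrableOn_source hK hφ.2.2) hφ.contDiff_one
  simp only [zero_mul, add_zero, inner_zero_left, zero_add] at i1 i2 i3
  have hms := h.isOpen.measurableSet
  have e1 : ∀ x, A ‖gradient u x‖ * inner ℝ (gradient u x) (gradient φ x) =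
      inner ℝ (flux A u x) (gradient φ x) := fun x => by rw [flux, real_inner_smul_left]
  rw [integral_congr_ae (Eventually.of_forall e1)] at hw
  rw [setIntegral_eq_of_tsupport hms hφ.2.2 (fun x hx => by rw [hzg x hx, inner_zero_right]),
    setIntegral_eq_of_tsupport hms hφ.2.2 (fun x hx => by rw [hz x hx, mul_zero]),
    setIntegral_eq_of_tsupport hms hφ.2.2 (fun x hx => by rw [hz x hx, mul_zero])] at hw
  rw [setIntegral_eq_of_tsupport hms hφ.2.2 (fun x hx => by rw [hz x hx, hzg x hx]; simp)]
  simp only [sub_mul]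
  have e2 := integral_add i1 (i2.sub i3)
  have e3 := integral_sub i2 i3
  simp only [Pi.sub_apply] at e2
  linarith

/-- The equation differentiated in the direction `v`, off the critical set. -/
theorem differentiated_equation (h : IsSignedSolution x₀ ρ m M K θ Chat c F Ω A B f u)
    {g : RSpace N → RSpace N} (hgm : AEStronglyMeasurable g (volume.restrict Ω))
    (hgF : ∀ᵐ x ∂(volume.restrict Ω), ‖g x‖ ≤ F) (hg : IsWeakGradient Ω f g) (v : RSpace N)
    {ψ : RSpace N → ℝ} (hψ : ContDiff ℝ 1 ψ) (hc : HasCompactSupport ψ)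
    (hs : tsupport ψ ⊆ Ω \ criticalSet u) :
    Integrable (fun x => inner ℝ (fderiv ℝ (flux A u) x v - B ‖gradient u x‖ • v) (gradient ψ x) +
      (-inner ℝ (g x) v) * ψ x) ∧
    ∫ x in Ω, (inner ℝ (fderiv ℝ (flux A u) x v - B ‖gradient u x‖ • v) (gradient ψ x) +
      (-inner ℝ (g x) v) * ψ x) = 0 := by
  have hdV : ContinuousOn (fun x => fderiv ℝ (flux A u) x v) (Ω \ criticalSet u) :=
    (h.contDiffOn_flux.continuousOn_fderiv_of_isOpen h.isOpen_regular le_rfl).clm_apply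
      continuousOn_const
  have hBc : ContinuousOn (fun x => B ‖gradient u x‖ • v) (Ω \ criticalSet u) :=
    (h.continuousOn_lowerOrder.mono sdiff_subset).smul continuousOn_const
  have hX : ∀ S, IsCompact S → S ⊆ Ω \ criticalSet u →
      IntegrableOn (fun x => fderiv ℝ (flux A u) x v) S :=
    fun S hS hSU => (hdV.mono hSU).integrableOn_compact hS
  have hBi : ∀ S, IsCompact S → S ⊆ Ω \ criticalSet u →
      IntegrableOn (fun x => B ‖gradient u x‖ • v) S :=
    fun S hS hSU => (hBc.mono hSU).integrableOn_compact hS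
  have hY : ∀ S, IsCompact S → S ⊆ Ω \ criticalSet u →
      IntegrableOn (fun x => -inner ℝ (g x) v) S := fun S hS hSU => by
    have hle : volume.restrict S ≤ volume.restrict Ω :=
      Measure.restrict_mono (hSU.trans sdiff_subset) le_rfl
    have : IntegrableOn (fun _ : RSpace N => F * ‖v‖) S :=
      continuousOn_const.integrableOn_compact hS
    refine Integrable.mono' this
      ((hgm.mono_measure hle).inner aestronglyMeasurable_const).neg ?_
    filter_upwards [ae_mono hle hgF] with x hx
    rw [norm_neg]
    exact (norm_inner_le_norm _ _).trans (mul_le_mul_of_nonneg_right hx (norm_nonneg _))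
  refine ⟨integrable_weak_pairing hc.isCompact ((hX _ hc hs).sub (hBi _ hc hs)) (hY _ hc hs) hψ
    subset_rfl, ?_⟩
  refine weak_identity_of_contDiff_one
    (X := fun x => fderiv ℝ (flux A u) x v - B ‖gradient u x‖ • v)
    h.isOpen.measurableSet h.isOpen_regular sdiff_subset
    (fun S hS hSU => (hX S hS hSU).sub (hBi S hS hSU)) hY (fun φ hφ => ?_) hψ hc hs
  have hφΩ : IsTestFunction Ω φ := hφ.mono sdiff_subset
  have hK : IsCompact (tsupport φ) := hφ.2.1
  have hms := h.isOpen.measurableSet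
  have hz : ∀ x, x ∉ tsupport φ → φ x = 0 := fun x hx => image_eq_zero_of_notMem_tsupport hx
  have hzg : ∀ x, x ∉ tsupport φ → gradient φ x = 0 :=
    fun x hx => gradient_eq_zero_of_notMem_tsupport hx
  -- The equation is tested with ∂_v φ. The derivative is then moved onto the flux and onto f,
  -- whereas the lower-order term is not differentiated: B ∂_v φ is read as the field B v paired
  -- with ∇φ.
  have hw := h.weak_equation (hφΩ.fderiv_apply v).contDiff_one (hφΩ.fderiv_apply v).2.1
    (hφΩ.fderiv_apply v).2.2
  have hgr := hg φ hφΩ v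
  have hφ2 : ContDiff ℝ 2 φ := hφ.1.of_le (by norm_cast)
  have hGφ : ContDiff ℝ 1 (gradient φ) :=
    (LinearIsometryEquiv.contDiff _).comp (hφ2.fderiv_right (m := 1) (by norm_num))
  simp only [gradient_fderiv_apply hφ2 v] at hw
  have hzD : ∀ x, x ∉ tsupport φ → fderiv ℝ (gradient φ) x v = 0 := fun x hx => by
    rw [← gradient_fderiv_apply hφ2]
    exact gradient_eq_zero_of_notMem_tsupport fun h' =>
      hx (tsupport_fderiv_apply_subset ℝ v h')
  have hzf : ∀ x, x ∉ tsupport φ → fderiv ℝ φ x v = 0 := fun x hx => by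
    rw [← inner_gradient_left, hzg x hx, inner_zero_left]
  have cV := h.contDiffOn_flux.continuousOn.mono hφ.2.2
  have cD : Continuous fun x => fderiv ℝ (gradient φ) x v :=
    (hGφ.continuous_fderiv one_ne_zero).clm_apply continuous_const
  have cG := hGφ.continuous
  have j1 : Integrable fun x => inner ℝ (fderiv ℝ (flux A u) x v) (gradient φ x) :=
    integrable_of_continuousOn_compact hK ((hdV.mono hφ.2.2).inner cG.continuousOn)
      fun x hx => by rw [hzg x hx, inner_zero_right]
  have j2 : Integrable fun x => inner ℝ (flux A u x) (fderiv ℝ (gradient φ) x v) :=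
    integrable_of_continuousOn_compact hK (cV.inner cD.continuousOn)
      fun x hx => by rw [hzD x hx, inner_zero_right]
  have j3 : Integrable fun x => inner ℝ (flux A u x) (gradient φ x) :=
    integrable_of_continuousOn_compact hK (cV.inner cG.continuousOn)
      fun x hx => by rw [hzg x hx, inner_zero_right]
  have hts : tsupport (gradient φ) ⊆ tsupport φ :=
    closure_minimal (fun x hx => by by_contra h'; exact hx (hzg x h')) (isClosed_tsupport _)
  -- The support of φ avoids the critical set, so the flux is `C^1` where it is differentiated.
  have ibp : ∫ x, inner ℝ (flux A u x) (fderiv ℝ (gradient φ) x v) =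
      -∫ x, inner ℝ (fderiv ℝ (flux A u) x v) (gradient φ x) :=
    integral_bilinear_hasFDerivAt_right_eq_neg_left_of_integrable (μ := volume)
    (f := flux A u) (f' := fderiv ℝ (flux A u)) (g := gradient φ) (g' := fderiv ℝ (gradient φ))
    (v := v) (B := innerSL ℝ) j1 j2 j3
    (fun x hx => ((h.contDiffOn_flux.differentiableOn one_ne_zero).differentiableAt
      (h.isOpen_regular.mem_nhds (hφ.2.2 (hts hx)))).hasFDerivAt)
    (fun x _ => (hGφ.differentiable one_ne_zero x).hasFDerivAt)
  have i1 := integrableOn_weak_pairing hK (hX _ hK hφ.2.2)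
    (Y := fun _ => 0) integrableOn_zero hφ.contDiff_one
  have i2 := integrableOn_weak_pairing hK (hBi _ hK hφ.2.2)
    (Y := fun _ => 0) integrableOn_zero hφ.contDiff_one
  have i3 := integrableOn_weak_pairing hK (X := fun _ => 0) integrableOn_zero
    (hY _ hK hφ.2.2) hφ.contDiff_one
  have j4 : IntegrableOn (fun x => B ‖gradient u x‖ * fderiv ℝ φ x v) (tsupport φ) := by
    refine i2.congr_fun (fun x _ => ?_) hK.measurableSet
    simp only [zero_mul, add_zero, inner_gradient_right, RCLike.conj_to_real, map_smul, smul_eq_mul]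
  have j5 : IntegrableOn (fun x => f x * fderiv ℝ φ x v) (tsupport φ) := by
    have := integrableOn_weak_pairing hK (X := fun _ => 0) integrableOn_zero
      (h.integrableOn_source hK hφΩ.2.2) (hφΩ.fderiv_apply v).contDiff_one
    simpa using this
  have cΩ : ∀ P : RSpace N → ℝ, (∀ x, x ∉ tsupport φ → P x = 0) →
      ∫ x in Ω, P x = ∫ x in tsupport φ, P x := fun P hP =>
    setIntegral_eq_of_tsupport hms hφΩ.2.2 hP
  have cE : ∀ P : RSpace N → ℝ, (∀ x, x ∉ tsupport φ → P x = 0) →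
      ∫ x, P x = ∫ x in tsupport φ, P x := fun P hP =>
    (setIntegral_eq_integral_of_forall_compl_eq_zero hP).symm
  simp only [zero_mul, add_zero, inner_zero_left, zero_add] at i1 i2 i3
  rw [cΩ _ fun x hx => by rw [hzf x hx, mul_zero], cΩ _ fun x hx => by rw [hz x hx, mul_zero]] at hgr
  rw [cE _ fun x hx => by rw [hzD x hx, inner_zero_right],
    cE _ fun x hx => by rw [hzg x hx, inner_zero_right]] at ibp
  rw [cΩ _ fun x hx => by rw [hzD x hx, hzf x hx, inner_zero_right, mul_zero, add_zero]] at hw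
  rw [cΩ _ fun x hx => by rw [hzg x hx, hz x hx, inner_zero_right, mul_zero, add_zero]]
  simp only [sub_mul] at hw
  simp only [inner_sub_left]
  have s1 := integral_add j2.integrableOn (j4.sub j5)
  have s2 := integral_sub j4 j5
  have s3 := integral_add (i1.sub i2) i3
  have s4 := integral_sub i1 i2
  simp only [Pi.sub_apply] at s1 s3
  have e2 : ∫ x in tsupport φ, inner ℝ (B ‖gradient u x‖ • v) (gradient φ x) =
      ∫ x in tsupport φ, B ‖gradient u x‖ * fderiv ℝ φ x v := by
    congr 1; funext x
    rw [real_inner_smul_left, inner_gradient_right, RCLike.conj_to_real]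
  have e3 : ∫ x in tsupport φ, -inner ℝ (g x) v * φ x =
      -∫ x in tsupport φ, inner ℝ (g x) v * φ x := by
    rw [← integral_neg]; congr 1; funext x; ring
  linarith

end IsSignedSolution

/-! ### The weighted second-order estimate -/

/-- With μ = tA'/A, the logarithmic derivative of A (tA)^(-τ) times t is μ - τ(1+μ) = (1-τ)(1+μ) -
1. -/
theorem AdmissibleA.hasDerivAt_weight {A : ℝ → ℝ} {m M K θ τ d t : ℝ}
    (hA : AdmissibleA A m M K θ) (ht : 0 < t) :
    HasDerivAt (fun t => cutoffRatio d t * (A t * (t * A t) ^ (-τ)))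
      (A t * (t * A t) ^ (-τ) * (cutoffRatioDeriv d t -
        (1 - (1 - τ) * (1 + t * deriv A t / A t)) * cutoffRatio d t / t)) t := by
  have hAt := hA.pos t ht
  have h1 := (hA.hasDerivAt_mul ht).rpow_const (p := -τ) (Or.inl (mul_pos ht hAt).ne')
  refine ((hasDerivAt_cutoffRatio ht).mul ((hA.hasDerivAt ht).mul h1)).congr_deriv ?_
  rw [Real.rpow_sub_one (mul_pos ht hAt).ne']
  simp only [Pi.mul_apply]
  field_simp
  ring

theorem AdmissibleA.contDiffOn_weight {A : ℝ → ℝ} {m M K θ τ d : ℝ}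
    (hA : AdmissibleA A m M K θ) :
    ContDiffOn ℝ 1 (fun t => cutoffRatio d t * (A t * (t * A t) ^ (-τ))) (Ioi 0) :=
  (contDiffOn_cutoffRatio d).mul (hA.contDiffOn.mul
    ((contDiffOn_id.mul hA.contDiffOn).rpow_const_of_ne
      fun t ht => (mul_pos ht (hA.pos t ht)).ne'))

/-- The squared Hilbert--Schmidt norm of the Hessian of `u`. -/
noncomputable def sqHessian {N : ℕ} (u : RSpace N → ℝ) (x : RSpace N) : ℝ :=
  sqFrobenius (EuclideanSpace.basisFun (Fin N) ℝ) (fderiv ℝ (gradient u) x)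

theorem IsTestFunction.integrable_sq_add {N : ℕ} {Ω : Set (RSpace N)} {ζ : RSpace N → ℝ}
    (h : IsTestFunction Ω ζ) : Integrable (fun x => ζ x ^ 2 + ‖gradient ζ x‖ ^ 2) := by
  have hK : IsCompact (tsupport ζ) := h.2.1
  refine integrable_of_continuousOn_compact hK ?_ fun x hx => ?_
  · exact ((h.1.continuous.pow 2).add
      ((continuous_gradient h.contDiff_one).norm.pow 2)).continuousOn
  · rw [image_eq_zero_of_notMem_tsupport hx, gradient_eq_zero_of_notMem_tsupport hx]
    simp

theorem IsTestFunction.hasGradientAt_sq {N : ℕ} {Ω : Set (RSpace N)} {ζ : RSpace N → ℝ}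
    (h : IsTestFunction Ω ζ) (x : RSpace N) :
    HasGradientAt (fun y => ζ y ^ 2) ((2 * ζ x) • gradient ζ x) x := by
  have := (hasDerivAt_pow 2 (ζ x)).comp_hasGradientAt (hasGradientAt_of_contDiff h.contDiff_one x)
  simpa using this

namespace IsSignedSolution

variable {N : ℕ} {x₀ : RSpace N} {ρ m M K θ Chat c F : ℝ} {Ω : Set (RSpace N)} {A B : ℝ → ℝ}
  {f u : RSpace N → ℝ}

theorem continuousOn_sqHessian (h : IsSignedSolution x₀ ρ m M K θ Chat c F Ω A B f u) :
    ContinuousOn (sqHessian u) (Ω \ criticalSet u) := by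
  unfold sqHessian sqFrobenius
  exact continuousOn_finsetSum _ fun i _ =>
    ((h.continuousOn_hessian.clm_apply continuousOn_const).norm).pow 2

theorem isCompact_tsupport_inter (h : IsSignedSolution x₀ ρ m M K θ Chat c F Ω A B f u)
    {ζ : RSpace N → ℝ} (hζ : IsTestFunction Ω ζ) (d : ℝ) :
    IsCompact (tsupport ζ ∩ {x | d ≤ ‖gradient u x‖}) := by
  have hK : IsCompact (tsupport ζ) := hζ.2.1
  have h1 : IsClosed (tsupport ζ ∩ (fun x => ‖gradient u x‖) ⁻¹' Ici d) :=
    ((h.continuousOn_gradient.mono hζ.2.2).norm).preimage_isClosed_of_isClosed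
      hK.isClosed isClosed_Ici
  exact hK.of_isClosed_subset h1 inter_subset_left

theorem tsupport_inter_subset {ζ : RSpace N → ℝ} (hζ : IsTestFunction Ω ζ) {d : ℝ} (hd : 0 < d) :
    tsupport ζ ∩ {x | d ≤ ‖gradient u x‖} ⊆ Ω \ criticalSet u := fun x hx => by
  refine ⟨hζ.2.2 hx.1, fun h0 => ?_⟩
  have h1 : gradient u x = 0 := h0
  have h2 : d ≤ ‖gradient u x‖ := hx.2
  rw [h1, norm_zero] at h2
  linarith

theorem integrable_hessian_cutoff (h : IsSignedSolution x₀ ρ m M K θ Chat c F Ω A B f u)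
    {ζ : RSpace N → ℝ} (hζ : IsTestFunction Ω ζ) {d : ℝ} (hd : 0 < d) (τ : ℝ) :
    Integrable (fun x => cutoffRatio d ‖gradient u x‖ * (A ‖gradient u x‖ ^ 2 *
      (‖gradient u x‖ * A ‖gradient u x‖) ^ (-τ) * sqHessian u x * ζ x ^ 2)) := by
  have hS := h.isCompact_tsupport_inter hζ d
  have hSU := tsupport_inter_subset (u := u) hζ hd
  have hA := h.admissibleA
  refine integrable_of_continuousOn_compact hS ?_ fun x hx => ?_
  · have h1 : ContinuousOn (fun t => cutoffRatio d t * (A t ^ 2 * (t * A t) ^ (-τ))) (Ioi 0) :=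
      (contDiffOn_cutoffRatio d).continuousOn.mul ((hA.contDiffOn.continuousOn.pow 2).mul
        ((continuousOn_id.mul hA.contDiffOn.continuousOn).rpow_const
          fun t ht => Or.inl (mul_pos ht (hA.pos t ht)).ne'))
    have h2 := h1.comp h.contDiffOn_norm.continuousOn fun x hx => norm_gradient_pos hx
    refine (((h2.mul h.continuousOn_sqHessian).mono hSU).mul
      (hζ.1.continuous.pow 2).continuousOn).congr fun x _ => ?_
    simp only [Function.comp, Pi.mul_apply, Pi.pow_apply]
    ring
  · by_cases hx1 : x ∈ tsupport ζ
    · have : ‖gradient u x‖ ≤ d := by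
        by_contra hlt
        exact hx ⟨hx1, (not_le.1 hlt).le⟩
      rw [cutoffRatio_eq_zero this, zero_mul]
    · rw [image_eq_zero_of_notMem_tsupport hx1]
      ring

/-- The truncated weight `A(|∇u|) (|∇u| A(|∇u|))^(-τ) ζ²`, supported off the critical set. -/
noncomputable def cutWeight (A : ℝ → ℝ) (u ζ : RSpace N → ℝ) (τ d : ℝ) (x : RSpace N) : ℝ :=
  cutoffRatio d ‖gradient u x‖ *
    (A ‖gradient u x‖ * (‖gradient u x‖ * A ‖gradient u x‖) ^ (-τ)) * ζ x ^ 2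

theorem hasGradientAt_cutWeight (h : IsSignedSolution x₀ ρ m M K θ Chat c F Ω A B f u)
    {ζ : RSpace N → ℝ} (hζ : IsTestFunction Ω ζ) {d τ : ℝ} {x : RSpace N}
    (hx : x ∈ Ω \ criticalSet u) :
    HasGradientAt (cutWeight A u ζ τ d)
      ((A ‖gradient u x‖ * (‖gradient u x‖ * A ‖gradient u x‖) ^ (-τ) *
        (cutoffRatioDeriv d ‖gradient u x‖ -
        (1 - (1 - τ) * (1 + ‖gradient u x‖ * deriv A ‖gradient u x‖ / A ‖gradient u x‖)) *
          cutoffRatio d ‖gradient u x‖ / ‖gradient u x‖) * ζ x ^ 2) • gradNormGradient u x +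
      (cutoffRatio d ‖gradient u x‖ *
        (A ‖gradient u x‖ * (‖gradient u x‖ * A ‖gradient u x‖) ^ (-τ)) * (2 * ζ x)) •
        gradient ζ x) x := by
  have h1 := HasDerivAt.comp_hasGradientAt (f := fun y => ‖gradient u y‖)
    (h.admissibleA.hasDerivAt_weight (τ := τ) (d := d) (norm_gradient_pos hx))
    (h.hasGradientAt_norm hx)
  have h2 := h1.real_mul (hζ.hasGradientAt_sq x)
  rw [smul_smul, smul_smul, add_comm] at h2
  rw [mul_comm _ (ζ x ^ 2)]
  exact h2

theorem hasGradientAt_partial (h : IsSignedSolution x₀ ρ m M K θ Chat c F Ω A B f u)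
    {x : RSpace N} (hx : x ∈ Ω \ criticalSet u) (v : RSpace N) :
    HasGradientAt (fun y => inner ℝ (gradient u y) v) (fderiv ℝ (gradient u) x v) x := by
  rw [hasGradientAt_iff_hasFDerivAt]
  refine ((h.hasFDerivAt_gradient hx).inner ℝ (hasFDerivAt_const v x)).congr_fderiv ?_
  ext w
  simp [h.hessian_symm hx w v]

theorem hasGradientAt_second_order_test (h : IsSignedSolution x₀ ρ m M K θ Chat c F Ω A B f u)
    {ζ : RSpace N → ℝ} {d τ : ℝ} {x W : RSpace N}
    (hx : x ∈ Ω \ criticalSet u) (hW : HasGradientAt (cutWeight A u ζ τ d) W x) (v : RSpace N) :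
    gradient (fun y => inner ℝ (gradient u y) v * cutWeight A u ζ τ d y) x =
      cutWeight A u ζ τ d x • fderiv ℝ (gradient u) x v + inner ℝ (gradient u x) v • W := by
  rw [((h.hasGradientAt_partial hx v).real_mul hW).gradient, add_comm]

/-- The cutoff keeps the support in a compact set on which |∇u| ≥ d. For d > 0 that set lies off the
critical set, where u is `C^2`, so the test function is `C^1` on the whole space. -/
theorem tsupport_second_order_test (h : IsSignedSolution x₀ ρ m M K θ Chat c F Ω A B f u)
    {ζ : RSpace N → ℝ} (hζ : IsTestFunction Ω ζ) {d τ : ℝ} (v : RSpace N) :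
    tsupport (fun y => inner ℝ (gradient u y) v * cutWeight A u ζ τ d y) ⊆
      tsupport ζ ∩ {x | d ≤ ‖gradient u x‖} := by
  refine closure_minimal (fun x hx => ?_) (h.isCompact_tsupport_inter hζ d).isClosed
  by_contra hx'
  refine hx ?_
  dsimp only [cutWeight]
  by_cases hx1 : x ∈ tsupport ζ
  · have : ‖gradient u x‖ ≤ d := by
      by_contra hlt
      exact hx' ⟨hx1, (not_le.1 hlt).le⟩
    rw [cutoffRatio_eq_zero this]
    ring
  · rw [image_eq_zero_of_notMem_tsupport hx1]
    ring

theorem contDiff_second_order_test (h : IsSignedSolution x₀ ρ m M K θ Chat c F Ω A B f u)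
    {ζ : RSpace N → ℝ} (hζ : IsTestFunction Ω ζ) {d : ℝ} (hd : 0 < d) (τ : ℝ) (v : RSpace N) :
    ContDiff ℝ 1 (fun y => inner ℝ (gradient u y) v * cutWeight A u ζ τ d y) := by
  refine contDiff_of_contDiffOn_of_tsupport_subset h.isOpen_regular ?_
    ((h.tsupport_second_order_test hζ v).trans (tsupport_inter_subset hζ hd))
  exact (h.contDiffOn_gradient.inner ℝ contDiffOn_const).mul
    ((h.contDiffOn_comp_norm h.admissibleA.contDiffOn_weight).mul
      (hζ.contDiff_one.pow 2).contDiffOn)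

/-- The constant of the weighted second-order estimate. -/
noncomputable def hessianConstant (N : ℕ) (m M τ Chat F L Λ : ℝ) : ℝ :=
  Λ ^ (2 - τ) * (Chat ^ 2 * L ^ 2 / (2 * min 1 (1 + m)) +
    4 * (1 + |m| + |M|) ^ 2 / ((1 - τ) * min 1 (1 + m) ^ 2) +
    2 * (N + 1) * Chat ^ 2 * L ^ 2 / ((1 - τ) * min 1 (1 + m) ^ 2) +
    2 * (1 + (1 + |m| + |M|)) ^ 2 * Chat ^ 2 * L ^ 2 / ((1 - τ) * min 1 (1 + m) ^ 2) +
    Chat * (L ^ 2 + 1)) + |F| * Λ ^ (1 - τ)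

theorem hessianConstant_nonneg (N : ℕ) {m M τ Chat F L Λ : ℝ} (hm : -1 < m) (hτ1 : τ < 1)
    (hC : 0 ≤ Chat) (hΛ : 0 ≤ Λ) : 0 ≤ hessianConstant N m M τ Chat F L Λ := by
  have h1 : 0 < min 1 (1 + m) := lt_min one_pos (by linarith)
  have h2 : 0 < 1 - τ := by linarith
  unfold hessianConstant
  positivity

/-- The pointwise form of the weighted second-order estimate. -/
theorem second_order_pointwise (h : IsSignedSolution x₀ ρ m M K θ Chat c F Ω A B f u)
    {τ L Λ : ℝ} (hτ : 0 < τ) (hτ1 : τ < 1) {ζ : RSpace N → ℝ} (hζ : IsTestFunction Ω ζ)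
    {d : ℝ} (hd : 0 < d) {x w : RSpace N} (hx : x ∈ Ω \ criticalSet u) (hw : ‖w‖ ≤ |F|)
    (hL : ‖gradient u x‖ ≤ L) (hΛ : ‖gradient u x‖ * A ‖gradient u x‖ ≤ Λ) :
    (1 - τ) * min 1 (1 + m) ^ 2 / 2 * (cutoffRatio d ‖gradient u x‖ * (A ‖gradient u x‖ ^ 2 *
      (‖gradient u x‖ * A ‖gradient u x‖) ^ (-τ) * sqHessian u x * ζ x ^ 2)) -
      hessianConstant N m M τ Chat F L Λ * (ζ x ^ 2 + ‖gradient ζ x‖ ^ 2) ≤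
    ∑ i, (inner ℝ (fderiv ℝ (flux A u) x (EuclideanSpace.basisFun (Fin N) ℝ i) -
        B ‖gradient u x‖ • EuclideanSpace.basisFun (Fin N) ℝ i)
        (gradient (fun y => inner ℝ (gradient u y) (EuclideanSpace.basisFun (Fin N) ℝ i) *
          cutWeight A u ζ τ d y) x) +
      (-inner ℝ w (EuclideanSpace.basisFun (Fin N) ℝ i)) *
        (inner ℝ (gradient u x) (EuclideanSpace.basisFun (Fin N) ℝ i) *
          cutWeight A u ζ τ d x)) := by
  have ht := norm_gradient_pos hx
  have hA := h.admissibleA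
  have hAt := hA.pos _ ht
  have hv : 0 < ‖gradient u x‖ * A ‖gradient u x‖ := mul_pos ht hAt
  have hsymm := h.hessian_symm hx
  have hts := norm_smul_gradNormGradient hx
  have hW := h.hasGradientAt_cutWeight hζ (d := d) (τ := τ) hx
  set b := EuclideanSpace.basisFun (Fin N) ℝ with hb
  set W := (A ‖gradient u x‖ * (‖gradient u x‖ * A ‖gradient u x‖) ^ (-τ) *
        (cutoffRatioDeriv d ‖gradient u x‖ -
        (1 - (1 - τ) * (1 + ‖gradient u x‖ * deriv A ‖gradient u x‖ / A ‖gradient u x‖)) *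
          cutoffRatio d ‖gradient u x‖ / ‖gradient u x‖) * ζ x ^ 2) • gradNormGradient u x +
      (cutoffRatio d ‖gradient u x‖ *
        (A ‖gradient u x‖ * (‖gradient u x‖ * A ‖gradient u x‖) ^ (-τ)) * (2 * ζ x)) •
        gradient ζ x with hWdef
  have e0 : ∀ i, (inner ℝ (fderiv ℝ (flux A u) x (b i) - B ‖gradient u x‖ • b i)
        (gradient (fun y => inner ℝ (gradient u y) (b i) * cutWeight A u ζ τ d y) x) +
      (-inner ℝ w (b i)) * (inner ℝ (gradient u x) (b i) * cutWeight A u ζ τ d x)) =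
      inner ℝ (A ‖gradient u x‖ • fderiv ℝ (gradient u) x (b i) +
        (deriv A ‖gradient u x‖ * inner ℝ (gradNormGradient u x) (b i)) • gradient u x)
        (cutWeight A u ζ τ d x • fderiv ℝ (gradient u) x (b i) + inner ℝ (gradient u x) (b i) • W)
      - B ‖gradient u x‖ * inner ℝ (cutWeight A u ζ τ d x • fderiv ℝ (gradient u) x (b i) +
          inner ℝ (gradient u x) (b i) • W) (b i)
      - cutWeight A u ζ τ d x * (inner ℝ w (b i) * inner ℝ (b i) (gradient u x)) := by
    intro i
    rw [h.hasGradientAt_second_order_test hx hW, h.fderiv_flux hx, inner_sub_left,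
      real_inner_smul_left (b i) _ (B ‖gradient u x‖), real_inner_comm _ (b i),
      real_inner_comm (gradient u x) (b i)]
    ring
  rw [Finset.sum_congr rfl fun i _ => e0 i, Finset.sum_sub_distrib, Finset.sum_sub_distrib,
    ← Finset.mul_sum, ← Finset.mul_sum, sum_pairing_eq b hsymm hts, sum_inner_basis_eq,
    b.sum_inner_mul_inner]
  -- The three trace identities leave only scalar quantities. In the unit direction n one has D²u n
  -- = ∇|∇u|, which gives the hypotheses of the scalar inequality.
  set n := ‖gradient u x‖⁻¹ • gradient u x with hn
  have hn1 : ‖n‖ = 1 := by rw [hn, norm_smul, norm_inv, norm_norm, inv_mul_cancel₀ ht.ne']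
  have hHn : fderiv ℝ (gradient u) x n = gradNormGradient u x := by
    rw [hn, map_smul, gradNormGradient]
  have hG : gradient u x = ‖gradient u x‖ • n := by
    rw [hn, smul_smul, mul_inv_cancel₀ ht.ne', one_smul]
  have hμm : m ≤ ‖gradient u x‖ * deriv A ‖gradient u x‖ / A ‖gradient u x‖ := by
    rw [le_div_iff₀ hAt]; exact hA.le_mul_deriv ht
  have hμM : ‖gradient u x‖ * deriv A ‖gradient u x‖ / A ‖gradient u x‖ ≤ M := by
    rw [div_le_iff₀ hAt]; exact hA.mul_deriv_le ht
  have hnG : ∀ w : RSpace N, inner ℝ (gradient u x) w = ‖gradient u x‖ * inner ℝ n w :=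
    fun w => by conv_lhs => rw [hG, real_inner_smul_left]
  have hE := sq_norm_add_le_sqFrobenius b hsymm hn1 (hA.neg_one_lt.le.trans hμm)
  have hSD := sq_norm_apply_le_sqFrobenius b hsymm hn1
  have htr := sq_trace_le b (fderiv ℝ (gradient u) x)
  have hD0 := sqFrobenius_nonneg b (fderiv ℝ (gradient u) x)
  rw [hHn] at hE hSD
  -- This product and the next collapse to positive powers of tA, with exponents 2 - τ and 1 - τ,
  -- which explains the powers of Λ in `hessianConstant`.
  have hQ₁ : A ‖gradient u x‖ ^ 2 * (‖gradient u x‖ * A ‖gradient u x‖) ^ (-τ) *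
      ‖gradient u x‖ ^ 2 ≤ Λ ^ (2 - τ) := by
    have : A ‖gradient u x‖ ^ 2 * (‖gradient u x‖ * A ‖gradient u x‖) ^ (-τ) *
      ‖gradient u x‖ ^ 2 = (‖gradient u x‖ * A ‖gradient u x‖) ^ (2 - τ) := by
      rw [sub_eq_add_neg, Real.rpow_add hv, Real.rpow_two]; ring
    rw [this]
    exact Real.rpow_le_rpow hv.le hΛ (by linarith)
  have hQ₂ : A ‖gradient u x‖ * (‖gradient u x‖ * A ‖gradient u x‖) ^ (-τ) *
      ‖gradient u x‖ ≤ Λ ^ (1 - τ) := by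
    have : A ‖gradient u x‖ * (‖gradient u x‖ * A ‖gradient u x‖) ^ (-τ) *
      ‖gradient u x‖ = (‖gradient u x‖ * A ‖gradient u x‖) ^ (1 - τ) := by
      rw [sub_eq_add_neg, Real.rpow_add hv, Real.rpow_one]; ring
    rw [this]
    exact Real.rpow_le_rpow hv.le hΛ (by linarith)
  have key := second_order_pointwise_bound (m := m) (M := M) (τ := τ) (Chat := Chat) (F := |F|)
    (L := L) (N' := N + 1) (κ₀ := min 1 (1 + m)) hτ hτ1 h.admissibleB.Chat_pos.le (abs_nonneg F)
    (by linarith [(Nat.cast_nonneg N : (0 : ℝ) ≤ N)])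
    (lt_min one_pos (by linarith [hA.neg_one_lt])) (min_le_left _ _) (min_le_right _ _) rfl rfl
    hμm hμM hAt.le ht hL (Real.rpow_nonneg hv.le _)
    (cutoffRatio_nonneg d _) (cutoffRatio_le_one hd ht) (cutoffRatioDeriv_nonneg hd ht)
    (mul_cutoffRatioDeriv_le hd ht) hQ₁ hQ₂ (h.admissibleB.nonneg _ (norm_nonneg _))
    (hA.lowerOrder_le h.admissibleB (norm_nonneg _)) hSD (norm_nonneg _)
    (p := inner ℝ n (gradNormGradient u x))
    (by simpa [hn1] using abs_real_inner_le_norm n (gradNormGradient u x))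
    (norm_nonneg (gradient ζ x)) (abs_real_inner_le_norm (gradNormGradient u x) (gradient ζ x))
    (r := inner ℝ n (gradient ζ x))
    (by simpa [hn1] using abs_real_inner_le_norm n (gradient ζ x))
    (tr := ∑ i, inner ℝ (fderiv ℝ (gradient u) x (b i)) (b i))
    (by rw [Fintype.card_fin] at htr; linarith) hE
    (f := inner ℝ w (gradient u x))
    ((abs_real_inner_le_norm w (gradient u x)).trans
      (mul_le_mul_of_nonneg_right hw (norm_nonneg _))) (ζ := ζ x)
  refine key.trans (le_of_eq ?_)
  rw [real_inner_comm (gradient u x) (gradNormGradient u x), hnG, hnG, hWdef]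
  simp only [inner_add_right, real_inner_smul_right, real_inner_self_eq_norm_sq, cutWeight]
  field_simp
  ring

/-- The weighted second-order estimate. -/
theorem second_order_estimate (h : IsSignedSolution x₀ ρ m M K θ Chat c F Ω A B f u)
    {τ L Λ : ℝ} (hτ : 0 < τ) (hτ1 : τ < 1) (hΛ0 : 0 ≤ Λ) {ζ : RSpace N → ℝ}
    (hζ : IsTestFunction Ω ζ) {d : ℝ} (hd : 0 < d)
    (hL : ∀ x ∈ tsupport ζ, ‖gradient u x‖ ≤ L)
    (hΛ : ∀ x ∈ tsupport ζ, ‖gradient u x‖ * A ‖gradient u x‖ ≤ Λ) :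
    (1 - τ) * min 1 (1 + m) ^ 2 / 2 * ∫ x in Ω, (cutoffRatio d ‖gradient u x‖ *
      (A ‖gradient u x‖ ^ 2 * (‖gradient u x‖ * A ‖gradient u x‖) ^ (-τ) *
        sqHessian u x * ζ x ^ 2)) ≤
      hessianConstant N m M τ Chat F L Λ * ∫ x in Ω, (ζ x ^ 2 + ‖gradient ζ x‖ ^ 2) := by
  obtain ⟨g, hgm, hgF, hg⟩ := h.memSobolev.2
  have hC0 := hessianConstant_nonneg N (m := m) (M := M) (τ := τ) (Chat := Chat) (F := F) (L := L)
    (Λ := Λ) h.admissibleA.neg_one_lt hτ1 h.admissibleB.Chat_pos.le hΛ0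
  have hS := h.isCompact_tsupport_inter hζ d
  have hSU := tsupport_inter_subset (u := u) hζ hd
  have hd' := fun i => h.differentiated_equation hgm hgF hg (EuclideanSpace.basisFun (Fin N) ℝ i)
    (h.contDiff_second_order_test hζ hd τ (EuclideanSpace.basisFun (Fin N) ℝ i))
    (hS.of_isClosed_subset (isClosed_tsupport _) (h.tsupport_second_order_test hζ _))
    ((h.tsupport_second_order_test hζ _).trans hSU)
  have hi1 := (h.integrable_hessian_cutoff hζ hd τ).const_mul ((1 - τ) * min 1 (1 + m) ^ 2 / 2)
  have hi2 := hζ.integrable_sq_add.const_mul (hessianConstant N m M τ Chat F L Λ)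
  -- The differentiated equations sum to zero, so it suffices to integrate the pointwise lower bound
  -- for their integrand.
  have hsum := integral_finsetSum (μ := volume.restrict Ω) Finset.univ
    fun i _ => (hd' i).1.integrableOn (s := Ω)
  rw [Finset.sum_eq_zero fun i _ => (hd' i).2] at hsum
  rw [← sub_nonpos, ← integral_const_mul, ← integral_const_mul,
    ← integral_sub hi1.integrableOn hi2.integrableOn, ← hsum]
  refine integral_mono_ae (hi1.sub hi2).integrableOn
    (integrable_finsetSum _ fun i _ => (hd' i).1.integrableOn) ?_
  filter_upwards [hgF, ae_restrict_mem h.isOpen.measurableSet] with x hx hxΩ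
  by_cases hxS : x ∈ tsupport ζ ∩ {x | d ≤ ‖gradient u x‖}
  · exact h.second_order_pointwise hτ hτ1 hζ hd (hSU hxS) (hx.trans (le_abs_self F))
      (hL x hxS.1) (hΛ x hxS.1)
  · have hz : ∀ i, x ∉ tsupport (fun y => inner ℝ (gradient u y)
        (EuclideanSpace.basisFun (Fin N) ℝ i) * cutWeight A u ζ τ d y) := fun i hx' =>
      hxS (h.tsupport_second_order_test hζ _ hx')
    have hz0 : ∀ i, inner ℝ (gradient u x) (EuclideanSpace.basisFun (Fin N) ℝ i) *
        cutWeight A u ζ τ d x = 0 := fun i => by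
      by_contra hne
      exact hz i (subset_tsupport _ hne)
    rw [Finset.sum_eq_zero fun i _ => by
      rw [gradient_eq_zero_of_notMem_tsupport (hz i), hz0, inner_zero_right, mul_zero, add_zero]]
    have h0 : cutoffRatio d ‖gradient u x‖ * (A ‖gradient u x‖ ^ 2 *
        (‖gradient u x‖ * A ‖gradient u x‖) ^ (-τ) * sqHessian u x * ζ x ^ 2) = 0 := by
      by_cases hx1 : x ∈ tsupport ζ
      · have : ‖gradient u x‖ ≤ d := by
          by_contra hlt
          exact hxS ⟨hx1, (not_le.1 hlt).le⟩
        rw [cutoffRatio_eq_zero this, zero_mul]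
      · rw [image_eq_zero_of_notMem_tsupport hx1]
        ring
    simp only [h0]
    have : 0 ≤ hessianConstant N m M τ Chat F L Λ * (ζ x ^ 2 + ‖gradient ζ x‖ ^ 2) := by positivity
    linarith

end IsSignedSolution

/-! ### Summability of negative powers of |∇u| A(|∇u|) -/

/-- Real powers are continuous on [0,∞], so the limit is also correct at v = 0, where it equals ∞ if
τ > 0. -/
theorem tendsto_truncatedPower {τ v : ℝ} (hv : 0 ≤ v) :
    Tendsto (fun n : ℕ => ENNReal.ofReal (truncatedPower τ (1 / ((n : ℝ) + 1)) v)) atTop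
      (𝓝 (ENNReal.ofReal v ^ (-τ))) := by
  have h1 : ∀ n : ℕ, ENNReal.ofReal (truncatedPower τ (1 / ((n : ℝ) + 1)) v) =
      ENNReal.ofReal ((1 / ((n : ℝ) + 1)) ^ 2 + max (v - 1 / ((n : ℝ) + 1)) 0 ^ 2) ^ (-τ / 2) := by
    intro n
    rw [truncatedPower, ENNReal.ofReal_rpow_of_pos (by positivity)]
  simp only [h1]
  have h2 : ENNReal.ofReal v ^ (-τ) = ENNReal.ofReal (0 ^ 2 + max (v - 0) 0 ^ 2) ^ (-τ / 2) := by
    rw [sub_zero, max_eq_left hv, zero_pow two_ne_zero, zero_add, ENNReal.ofReal_pow hv,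
      ← ENNReal.rpow_natCast, ← ENNReal.rpow_mul]
    congr 1
    push_cast
    ring
  rw [h2]
  refine (ENNReal.continuous_rpow_const.tendsto _).comp (ENNReal.tendsto_ofReal ?_)
  have h3 : Continuous fun e : ℝ => e ^ 2 + max (v - e) 0 ^ 2 := by fun_prop
  exact (h3.tendsto 0).comp tendsto_one_div_add_atTop_nhds_zero_nat

namespace IsSignedSolution

variable {N : ℕ} {x₀ : RSpace N} {ρ m M K θ Chat c F : ℝ} {Ω : Set (RSpace N)} {A B : ℝ → ℝ}
  {f u : RSpace N → ℝ}

/-- The constant of the weighted summability estimate. -/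
noncomputable def summabilityConstant (N : ℕ) (m M τ Chat F L Λ c : ℝ) : ℝ :=
  2 / c * (16 * (1 + M) ^ 2 / c *
    (hessianConstant N m M τ Chat F L Λ / ((1 - τ) * min 1 (1 + m) ^ 2 / 2)) +
    2 * (1 + Chat * L) * Λ ^ (1 - τ))

/-- The `C^1` function `truncatedPower τ ε (|∇u| A(|∇u|)) ζ²`. -/
noncomputable def powerTest (A : ℝ → ℝ) (u ζ : RSpace N → ℝ) (τ ε : ℝ) (x : RSpace N) : ℝ :=
  truncatedPower τ ε (‖gradient u x‖ * A ‖gradient u x‖) * ζ x ^ 2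

theorem tsupport_powerTest {ζ : RSpace N → ℝ} {τ ε : ℝ} :
    tsupport (powerTest A u ζ τ ε) ⊆ tsupport ζ := by
  refine closure_mono fun x hx hx' => hx ?_
  rw [powerTest, hx']
  ring

/-- Near a critical point |V| < ε, hence the truncated power is the constant ε^(-τ) and no second
derivative of u is needed there. -/
theorem contDiff_powerTest (h : IsSignedSolution x₀ ρ m M K θ Chat c F Ω A B f u)
    {ζ : RSpace N → ℝ} (hζ : IsTestFunction Ω ζ) {τ ε : ℝ} (hε : 0 < ε) :
    ContDiff ℝ 1 (powerTest A u ζ τ ε) := by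
  have hA := h.admissibleA
  have hζ2 : ContDiff ℝ 1 fun x => ζ x ^ 2 := hζ.contDiff_one.pow 2
  refine contDiff_iff_contDiffAt.2 fun x => ?_
  by_cases hx : x ∈ tsupport ζ
  · have hxΩ := hζ.2.2 hx
    by_cases hc : x ∈ criticalSet u
    · have h0 : ‖gradient u x‖ * A ‖gradient u x‖ < ε := by
        have : gradient u x = 0 := hc
        rw [this, norm_zero, zero_mul]
        exact hε
      have hcont : ContinuousAt (fun y => ‖gradient u y‖ * A ‖gradient u y‖) x := by
        have := (h.continuousOn_flux.continuousAt (h.isOpen.mem_nhds hxΩ)).norm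
        simpa only [h.norm_flux] using this
      have hev : powerTest A u ζ τ ε =ᶠ[𝓝 x] fun y => ε ^ (-τ) * ζ y ^ 2 := by
        filter_upwards [hcont.eventually (gt_mem_nhds h0)] with y hy
        rw [powerTest, truncatedPower_of_le hε hy.le]
      exact (contDiff_const.mul hζ2).contDiffAt.congr_of_eventuallyEq hev
    · have h1 : ContDiffOn ℝ 1 (fun t => truncatedPower τ ε (t * A t)) (Ioi 0) :=
        (contDiff_truncatedPower hε).comp_contDiffOn (contDiffOn_id.mul hA.contDiffOn)
      exact ((h.contDiffOn_comp_norm h1).mul hζ2.contDiffOn).contDiffAt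
        (h.isOpen_regular.mem_nhds ⟨hxΩ, hc⟩)
  · exact contDiffAt_const.congr_of_eventuallyEq
      (notMem_tsupport_iff_eventuallyEq.1 fun h' => hx (tsupport_powerTest h'))

theorem gradient_powerTest (h : IsSignedSolution x₀ ρ m M K θ Chat c F Ω A B f u)
    {ζ : RSpace N → ℝ} (hζ : IsTestFunction Ω ζ) {τ ε : ℝ} (hε : 0 < ε) {x : RSpace N}
    (hx : x ∈ Ω \ criticalSet u) :
    gradient (powerTest A u ζ τ ε) x =
      (truncatedPower τ ε (‖gradient u x‖ * A ‖gradient u x‖) * (2 * ζ x)) • gradient ζ x +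
      (ζ x ^ 2 * (truncatedPowerDeriv τ ε (‖gradient u x‖ * A ‖gradient u x‖) *
        (A ‖gradient u x‖ + ‖gradient u x‖ * deriv A ‖gradient u x‖))) • gradNormGradient u x := by
  have h1 : HasDerivAt (fun t => truncatedPower τ ε (t * A t)) _ ‖gradient u x‖ :=
    HasDerivAt.comp (h := fun t => t * A t) ‖gradient u x‖
      (hasDerivAt_truncatedPower (τ := τ) hε (‖gradient u x‖ * A ‖gradient u x‖))
      (h.admissibleA.hasDerivAt_mul (norm_gradient_pos hx))
  have h2 := (HasDerivAt.comp_hasGradientAt (f := fun y => ‖gradient u y‖) h1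
    (h.hasGradientAt_norm hx)).real_mul (hζ.hasGradientAt_sq x)
  rw [smul_smul, smul_smul] at h2
  exact h2.gradient

/-- The derivative of the power, paired with V, is at most 2(1+M) k A |∇|∇u|| ζ², where k is the
truncated power. Young's inequality gives up c/2 of k ζ², which the source term can absorb, and
leaves the integrand of the second-order estimate. -/
theorem powerTest_pointwise (h : IsSignedSolution x₀ ρ m M K θ Chat c F Ω A B f u) (hc : 0 < c)
    {τ L Λ : ℝ} (hτ : 0 < τ) (hτ1 : τ < 1) {ζ : RSpace N → ℝ} (hζ : IsTestFunction Ω ζ)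
    {ε d : ℝ} (hε : 0 < ε) (hd : 0 < d) (hdε : ∀ t, 0 < t → t ≤ 2 * d → t * A t < ε)
    {x : RSpace N} (hx : x ∈ Ω \ criticalSet u)
    (hL : ‖gradient u x‖ ≤ L) (hΛ : ‖gradient u x‖ * A ‖gradient u x‖ ≤ Λ) :
    |inner ℝ (flux A u x) (gradient (powerTest A u ζ τ ε) x)| +
        B ‖gradient u x‖ * powerTest A u ζ τ ε x ≤
      c / 2 * powerTest A u ζ τ ε x + 16 * (1 + M) ^ 2 / c *
        (cutoffRatio d ‖gradient u x‖ * (A ‖gradient u x‖ ^ 2 *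
          (‖gradient u x‖ * A ‖gradient u x‖) ^ (-τ) * sqHessian u x * ζ x ^ 2)) +
        2 * (1 + Chat * L) * Λ ^ (1 - τ) * (ζ x ^ 2 + ‖gradient ζ x‖ ^ 2) := by
  have ht := norm_gradient_pos hx
  have hA := h.admissibleA
  have hAt := hA.pos _ ht
  have hv : 0 < ‖gradient u x‖ * A ‖gradient u x‖ := mul_pos ht hAt
  have hCh := h.admissibleB.Chat_pos
  have hB := hA.lowerOrder_le h.admissibleB ht.le
  have hHn : fderiv ℝ (gradient u) x (‖gradient u x‖⁻¹ • gradient u x) = gradNormGradient u x := by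
    rw [map_smul, gradNormGradient]
  have hSD := sq_norm_apply_le_sqFrobenius (EuclideanSpace.basisFun (Fin N) ℝ) (h.hessian_symm hx)
    (n := ‖gradient u x‖⁻¹ • gradient u x)
    (by rw [norm_smul, norm_inv, norm_norm, inv_mul_cancel₀ ht.ne'])
  rw [hHn, ← sqHessian] at hSD
  have hm1 : 0 ≤ A ‖gradient u x‖ + ‖gradient u x‖ * deriv A ‖gradient u x‖ := by
    nlinarith [hA.le_mul_deriv ht, hA.neg_one_lt]
  have hM1 : A ‖gradient u x‖ + ‖gradient u x‖ * deriv A ‖gradient u x‖ ≤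
      (1 + M) * A ‖gradient u x‖ := by
    linarith [hA.mul_deriv_le ht]
  rw [h.gradient_powerTest hζ hε hx, powerTest]
  have hflux := h.norm_flux x
  set t := ‖gradient u x‖ with htdef
  set a := A t with hadef
  set k := truncatedPower τ ε (t * a) with hk
  set k' := truncatedPowerDeriv τ ε (t * a) with hk'
  set S := ‖gradNormGradient u x‖ with hS
  set D := sqHessian u x with hD
  set z := ‖gradient ζ x‖ with hz
  have hk0 : 0 < k := truncatedPower_pos hε _
  have hkv : k ≤ 2 * (t * a) ^ (-τ) := truncatedPower_le hτ hτ1 hε hv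
  have hkv' : |k'| * (t * a) ≤ 2 * k := abs_truncatedPowerDeriv_mul_le hτ hτ1 hε hv.le
  have hS0 : 0 ≤ S := norm_nonneg _
  have hz0 : 0 ≤ z := norm_nonneg _
  have hD0 : 0 ≤ D := (sq_nonneg S).trans hSD
  have hkvΛ : k * (t * a) ≤ 2 * Λ ^ (1 - τ) := by
    have e : (t * a) ^ (-τ) * (t * a) = (t * a) ^ (1 - τ) := by
      rw [sub_eq_neg_add, Real.rpow_add hv, Real.rpow_one]
    calc k * (t * a) ≤ 2 * (t * a) ^ (-τ) * (t * a) := by gcongr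
      _ = 2 * (t * a) ^ (1 - τ) := by rw [mul_assoc, e]
      _ ≤ _ := by
        gcongr
  have hM0 : 0 ≤ 1 + M := by
    have := hm1.trans hM1
    exact nonneg_of_mul_nonneg_left this hAt
  -- the term containing the derivative of the power
  have T1 : ζ x ^ 2 * (|k'| * (a + t * deriv A t)) * (t * a * S) ≤
      c / 2 * (k * ζ x ^ 2) + 16 * (1 + M) ^ 2 / c *
        (cutoffRatio d t * (a ^ 2 * (t * a) ^ (-τ) * D * ζ x ^ 2)) := by
    have hr0 : 0 ≤ cutoffRatio d t := cutoffRatio_nonneg d t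
    rcases le_or_gt (t * a) ε with hle | hgt
    · have hk'0 : k' = 0 := truncatedPowerDeriv_eq_zero hle
      rw [hk'0, abs_zero, zero_mul, mul_zero, zero_mul]
      positivity
    -- Where the derivative of the truncated power is nonzero, tA > ε, which forces t > 2d. The
    -- constant 16 is 4 from the cutoff, 2 from `truncatedPower_le` and 2 from Young's inequality.
    · have h4 : 1 ≤ 4 * cutoffRatio d t := by
        refine le_cutoffRatio hd ?_
        by_contra hlt
        exact (hdε t ht (not_le.1 hlt).le).not_gt hgt
      have y1 : 2 * ((1 + M) * a * S) ≤ c / 2 + 2 * (1 + M) ^ 2 / c * (a ^ 2 * D) := by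
        have h5 : 0 ≤ (c - 2 * ((1 + M) * a * S)) ^ 2 / (2 * c) := by positivity
        have e : (c - 2 * ((1 + M) * a * S)) ^ 2 / (2 * c) =
            c / 2 + 2 * (1 + M) ^ 2 / c * (a ^ 2 * S ^ 2) - 2 * ((1 + M) * a * S) := by
          field_simp; ring
        have h6 : 2 * (1 + M) ^ 2 / c * (a ^ 2 * S ^ 2) ≤ 2 * (1 + M) ^ 2 / c * (a ^ 2 * D) := by
          gcongr
        linarith
      calc ζ x ^ 2 * (|k'| * (a + t * deriv A t)) * (t * a * S)
          = ζ x ^ 2 * ((a + t * deriv A t) * S) * (|k'| * (t * a)) := by ring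
        _ ≤ ζ x ^ 2 * ((1 + M) * a * S) * (2 * k) := by gcongr
        _ = (k * ζ x ^ 2) * (2 * ((1 + M) * a * S)) := by ring
        _ ≤ (k * ζ x ^ 2) * (c / 2 + 2 * (1 + M) ^ 2 / c * (a ^ 2 * D)) := by gcongr
        _ = c / 2 * (k * ζ x ^ 2) + (1 * k) * (2 * (1 + M) ^ 2 / c * (a ^ 2 * D) * ζ x ^ 2) := by
          ring
        _ ≤ c / 2 * (k * ζ x ^ 2) + (4 * cutoffRatio d t * (2 * (t * a) ^ (-τ))) *
            (2 * (1 + M) ^ 2 / c * (a ^ 2 * D) * ζ x ^ 2) := by gcongr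
        _ = _ := by ring
  have T2 : k * (2 * |ζ x|) * (t * a * z) ≤ 2 * Λ ^ (1 - τ) * (ζ x ^ 2 + z ^ 2) := by
    calc k * (2 * |ζ x|) * (t * a * z) = k * (t * a) * (2 * |ζ x| * z) := by ring
      _ ≤ k * (t * a) * (|ζ x| ^ 2 + z ^ 2) := by gcongr; exact two_mul_le_add_sq _ _
      _ ≤ 2 * Λ ^ (1 - τ) * (|ζ x| ^ 2 + z ^ 2) := by gcongr
      _ = _ := by rw [sq_abs]
  have T3 : B t * (k * ζ x ^ 2) ≤ 2 * (Chat * L) * Λ ^ (1 - τ) * (ζ x ^ 2 + z ^ 2) := by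
    have hL0 : 0 ≤ L := ht.le.trans hL
    calc B t * (k * ζ x ^ 2) ≤ Chat * (t ^ 2 * a) * (k * ζ x ^ 2) := by gcongr
      _ = Chat * t * (k * (t * a)) * ζ x ^ 2 := by ring
      _ ≤ Chat * L * (2 * Λ ^ (1 - τ)) * (ζ x ^ 2 + z ^ 2) := by
        have hΛ0 : 0 ≤ 2 * Λ ^ (1 - τ) := le_trans (by positivity) hkvΛ
        gcongr
        linarith [sq_nonneg z]
      _ = _ := by ring
  have T4 : |inner ℝ (flux A u x) ((k * (2 * ζ x)) • gradient ζ x +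
      (ζ x ^ 2 * (k' * (a + t * deriv A t))) • gradNormGradient u x)| ≤
      k * (2 * |ζ x|) * (t * a * z) + ζ x ^ 2 * (|k'| * (a + t * deriv A t)) * (t * a * S) := by
    rw [inner_add_right, real_inner_smul_right, real_inner_smul_right]
    refine (abs_add_le _ _).trans (add_le_add ?_ ?_)
    · rw [abs_mul, abs_mul, abs_mul, abs_two, abs_of_pos hk0]
      refine mul_le_mul_of_nonneg_left ?_ (by positivity)
      rw [← hflux]
      exact abs_real_inner_le_norm _ _
    · rw [abs_mul, abs_mul, abs_mul, abs_of_nonneg hm1, abs_of_nonneg (sq_nonneg (ζ x))]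
      refine mul_le_mul_of_nonneg_left ?_ (by positivity)
      rw [← hflux]
      exact abs_real_inner_le_norm _ _
  linarith

theorem integral_powerTest_le (h : IsSignedSolution x₀ ρ m M K θ Chat c F Ω A B f u) (hc : 0 < c)
    {τ L Λ : ℝ} (hτ : 0 < τ) (hτ1 : τ < 1) (hL0 : 0 ≤ L) (hΛ0 : 0 ≤ Λ) {ζ : RSpace N → ℝ}
    (hζ : IsTestFunction (Metric.ball x₀ (2 * ρ)) ζ) {ε : ℝ} (hε : 0 < ε)
    (hL : ∀ x ∈ tsupport ζ, ‖gradient u x‖ ≤ L)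
    (hΛ : ∀ x ∈ tsupport ζ, ‖gradient u x‖ * A ‖gradient u x‖ ≤ Λ) :
    ∫ x in Ω, powerTest A u ζ τ ε x ≤
      summabilityConstant N m M τ Chat F L Λ c * ∫ x in Ω, (ζ x ^ 2 + ‖gradient ζ x‖ ^ 2) := by
  have hζΩ := hζ.mono h.ball_subset
  -- The cutoff level is d = δ/2, so that tA < ε for t ≤ 2d. The level depends on ε, which is
  -- harmless as the second-order estimate is uniform in d.
  obtain ⟨δ, hδ, hδε⟩ := h.admissibleA.exists_mul_lt hε
  have hd : 0 < δ / 2 := by positivity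
  have hκ : 0 < (1 - τ) * min 1 (1 + m) ^ 2 / 2 := by
    have h1 : 0 < min 1 (1 + m) := lt_min one_pos (by linarith [h.admissibleA.neg_one_lt])
    have h2 : 0 < 1 - τ := by linarith
    positivity
  have hCh := h.admissibleB.Chat_pos
  have hest := h.second_order_estimate hτ hτ1 hΛ0 hζΩ hd hL hΛ
  have hK : IsCompact (tsupport ζ) := hζ.2.1
  have hψ := h.contDiff_powerTest hζΩ (τ := τ) hε
  have hψs : tsupport (powerTest A u ζ τ ε) ⊆ tsupport ζ := tsupport_powerTest
  have hψc : HasCompactSupport (powerTest A u ζ τ ε) :=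
    hK.of_isClosed_subset (isClosed_tsupport _) hψs
  have hψ0 : ∀ x, 0 ≤ powerTest A u ζ τ ε x := fun x =>
    mul_nonneg (truncatedPower_pos hε _).le (sq_nonneg _)
  have hweak := h.weak_equation hψ hψc (hψs.trans hζΩ.2.2)
  have iI : Integrable fun x => inner ℝ (flux A u x) (gradient (powerTest A u ζ τ ε) x) +
      (B ‖gradient u x‖ - f x) * powerTest A u ζ τ ε x :=
    integrable_weak_pairing hK ((h.continuousOn_flux.mono hζΩ.2.2).integrableOn_compact hK)
      (((h.continuousOn_lowerOrder.mono hζΩ.2.2).integrableOn_compact hK).sub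
        (h.integrableOn_source hK hζΩ.2.2)) hψ hψs
  have iψ : Integrable (powerTest A u ζ τ ε) := hψ.continuous.integrable_of_hasCompactSupport hψc
  have i1 := (h.integrable_hessian_cutoff hζΩ hd τ).const_mul (16 * (1 + M) ^ 2 / c)
  have i2 := hζ.integrable_sq_add.const_mul (2 * (1 + Chat * L) * Λ ^ (1 - τ))
  have hpt : ∀ x ∈ Ω, |inner ℝ (flux A u x) (gradient (powerTest A u ζ τ ε) x)| +
        B ‖gradient u x‖ * powerTest A u ζ τ ε x ≤
      c / 2 * powerTest A u ζ τ ε x + 16 * (1 + M) ^ 2 / c *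
        (cutoffRatio (δ / 2) ‖gradient u x‖ * (A ‖gradient u x‖ ^ 2 *
          (‖gradient u x‖ * A ‖gradient u x‖) ^ (-τ) * sqHessian u x * ζ x ^ 2)) +
        2 * (1 + Chat * L) * Λ ^ (1 - τ) * (ζ x ^ 2 + ‖gradient ζ x‖ ^ 2) := by
    intro x hxΩ
    by_cases hx : x ∈ tsupport ζ
    · by_cases hxc : x ∈ criticalSet u
      · have h0 : gradient u x = 0 := hxc
        have hf0 : flux A u x = 0 := by rw [flux, h0, smul_zero]
        have hr0 : cutoffRatio (δ / 2) ‖gradient u x‖ = 0 := cutoffRatio_eq_zero (by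
          rw [h0, norm_zero]; exact hd.le)
        rw [hf0, hr0, h0, norm_zero, h.admissibleB.map_zero, inner_zero_left, abs_zero]
        have := hψ0 x
        have : 0 ≤ c / 2 * powerTest A u ζ τ ε x := by positivity
        have : 0 ≤ 2 * (1 + Chat * L) * Λ ^ (1 - τ) * (ζ x ^ 2 + ‖gradient ζ x‖ ^ 2) := by
          positivity
        linarith
      · exact h.powerTest_pointwise hc hτ hτ1 hζΩ hε hd
          (fun t ht htd => hδε t ht (by linarith)) ⟨hxΩ, hxc⟩ (hL x hx) (hΛ x hx)
    · have e1 : powerTest A u ζ τ ε x = 0 :=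
        image_eq_zero_of_notMem_tsupport fun h' => hx (hψs h')
      rw [gradient_eq_zero_of_notMem_tsupport fun h' => hx (hψs h'), e1,
        gradient_eq_zero_of_notMem_tsupport hx, image_eq_zero_of_notMem_tsupport hx]
      simp
  have iR := ((iψ.const_mul (c / 2)).add i1).add i2
  have hmain : c * ∫ x in Ω, powerTest A u ζ τ ε x ≤
      ∫ x in Ω, (c / 2 * powerTest A u ζ τ ε x + 16 * (1 + M) ^ 2 / c *
        (cutoffRatio (δ / 2) ‖gradient u x‖ * (A ‖gradient u x‖ ^ 2 *
          (‖gradient u x‖ * A ‖gradient u x‖) ^ (-τ) * sqHessian u x * ζ x ^ 2)) +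
        2 * (1 + Chat * L) * Λ ^ (1 - τ) * (ζ x ^ 2 + ‖gradient ζ x‖ ^ 2)) := by
    rw [← integral_const_mul]
    -- The weak equation has integral zero, so it may be subtracted from the majorant when f ≥ c and
    -- added when f ≤ -c. In the second case B ≥ 0 has the favourable sign.
    rcases h.sign with hs | hs
    · have := integral_sub (μ := volume.restrict Ω) iR.integrableOn iI.integrableOn
      simp only [Pi.add_apply] at this
      rw [hweak, sub_zero] at this
      rw [← this]
      refine integral_mono_ae (iψ.const_mul c).integrableOn (iR.sub iI).integrableOn ?_
      have hs' := ae_restrict_of_ae (s := Ω)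
        ((ae_restrict_iff' Metric.isOpen_ball.measurableSet).1 hs)
      filter_upwards [hs', ae_restrict_mem h.isOpen.measurableSet] with x hx hxΩ
      have hp := hpt x hxΩ
      by_cases hxb : x ∈ tsupport ζ
      · have := mul_le_mul_of_nonneg_right (hx (hζ.2.2 hxb)) (hψ0 x)
        linarith [le_abs_self (inner ℝ (flux A u x) (gradient (powerTest A u ζ τ ε) x))]
      · have e1 : powerTest A u ζ τ ε x = 0 :=
          image_eq_zero_of_notMem_tsupport fun h' => hxb (hψs h')
        rw [e1] at hp ⊢
        linarith [le_abs_self (inner ℝ (flux A u x) (gradient (powerTest A u ζ τ ε) x))]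
    · have := integral_add (μ := volume.restrict Ω) iR.integrableOn iI.integrableOn
      simp only [Pi.add_apply] at this
      rw [hweak, add_zero] at this
      rw [← this]
      refine integral_mono_ae (iψ.const_mul c).integrableOn (iR.add iI).integrableOn ?_
      have hs' := ae_restrict_of_ae (s := Ω)
        ((ae_restrict_iff' Metric.isOpen_ball.measurableSet).1 hs)
      filter_upwards [hs', ae_restrict_mem h.isOpen.measurableSet] with x hx hxΩ
      have hp := hpt x hxΩ
      have hBψ := mul_nonneg (h.admissibleB.nonneg _ (norm_nonneg (gradient u x))) (hψ0 x)
      by_cases hxb : x ∈ tsupport ζ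
      · have := mul_le_mul_of_nonneg_right (hx (hζ.2.2 hxb)) (hψ0 x)
        linarith [neg_abs_le (inner ℝ (flux A u x) (gradient (powerTest A u ζ τ ε) x))]
      · have e1 : powerTest A u ζ τ ε x = 0 :=
          image_eq_zero_of_notMem_tsupport fun h' => hxb (hψs h')
        rw [e1] at hp ⊢
        linarith [neg_abs_le (inner ℝ (flux A u x) (gradient (powerTest A u ζ τ ε) x))]
  have s1 := integral_add (μ := volume.restrict Ω)
    ((iψ.const_mul (c / 2)).add i1).integrableOn i2.integrableOn
  have s2 := integral_add (μ := volume.restrict Ω)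
    (iψ.const_mul (c / 2)).integrableOn i1.integrableOn
  simp only [Pi.add_apply] at s1
  rw [s1, s2, integral_const_mul, integral_const_mul, integral_const_mul] at hmain
  set Q := ∫ x in Ω, (ζ x ^ 2 + ‖gradient ζ x‖ ^ 2)
  set P := ∫ x in Ω, powerTest A u ζ τ ε x
  set R := ∫ x in Ω, (cutoffRatio (δ / 2) ‖gradient u x‖ * (A ‖gradient u x‖ ^ 2 *
          (‖gradient u x‖ * A ‖gradient u x‖) ^ (-τ) * sqHessian u x * ζ x ^ 2))
  have hR : R ≤ hessianConstant N m M τ Chat F L Λ / ((1 - τ) * min 1 (1 + m) ^ 2 / 2) * Q := by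
    rw [div_mul_eq_mul_div, le_div_iff₀ hκ]
    linarith
  have hR' := mul_le_mul_of_nonneg_left hR (by positivity : 0 ≤ 16 * (1 + M) ^ 2 / c)
  -- The term (c/2) P of the majorant is absorbed on the left; P is finite because the power is
  -- truncated.
  have hfin : c / 2 * P ≤ (16 * (1 + M) ^ 2 / c * (hessianConstant N m M τ Chat F L Λ /
      ((1 - τ) * min 1 (1 + m) ^ 2 / 2)) + 2 * (1 + Chat * L) * Λ ^ (1 - τ)) * Q := by
    linarith
  have := mul_le_mul_of_nonneg_left hfin (by positivity : 0 ≤ 2 / c)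
  have e : 2 / c * (c / 2 * P) = P := by field_simp
  rw [e, ← mul_assoc] at this
  exact this

/-- Negative powers of `|∇u| A(|∇u|)` are locally summable. -/
theorem lintegral_rpow_le (h : IsSignedSolution x₀ ρ m M K θ Chat c F Ω A B f u) (hc : 0 < c)
    {τ L Λ : ℝ} (hτ : 0 < τ) (hτ1 : τ < 1) (hL0 : 0 ≤ L) (hΛ0 : 0 ≤ Λ) {ζ : RSpace N → ℝ}
    (hζ : IsTestFunction (Metric.ball x₀ (2 * ρ)) ζ)
    (hL : ∀ x ∈ tsupport ζ, ‖gradient u x‖ ≤ L)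
    (hΛ : ∀ x ∈ tsupport ζ, ‖gradient u x‖ * A ‖gradient u x‖ ≤ Λ) :
    ∫⁻ x in Ω, ENNReal.ofReal (‖gradient u x‖ * A ‖gradient u x‖) ^ (-τ) *
        ENNReal.ofReal (ζ x ^ 2) ≤
      ENNReal.ofReal (summabilityConstant N m M τ Chat F L Λ c *
        ∫ x in Ω, (ζ x ^ 2 + ‖gradient ζ x‖ ^ 2)) := by
  have hζΩ := hζ.mono h.ball_subset
  have hε : ∀ n : ℕ, 0 < 1 / ((n : ℝ) + 1) := fun n => by positivity
  have hcd := fun n : ℕ => h.contDiff_powerTest hζΩ (τ := τ) (hε n)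
  have hcs : ∀ n : ℕ, HasCompactSupport (powerTest A u ζ τ (1 / ((n : ℝ) + 1))) := fun n =>
    IsCompact.of_isClosed_subset hζ.2.1 (isClosed_tsupport _) tsupport_powerTest
  have h0 : ∀ (n : ℕ) x, 0 ≤ powerTest A u ζ τ (1 / ((n : ℝ) + 1)) x := fun n x =>
    mul_nonneg (truncatedPower_pos (hε n) _).le (sq_nonneg _)
  have hlim : ∀ x, Tendsto (fun n : ℕ => ENNReal.ofReal (powerTest A u ζ τ (1 / ((n : ℝ) + 1)) x))
      atTop (𝓝 (ENNReal.ofReal (‖gradient u x‖ * A ‖gradient u x‖) ^ (-τ) *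
        ENNReal.ofReal (ζ x ^ 2))) := by
    intro x
    have hv : 0 ≤ ‖gradient u x‖ * A ‖gradient u x‖ := by
      rw [← h.norm_flux]; exact norm_nonneg _
    have := ENNReal.Tendsto.mul_const (tendsto_truncatedPower (τ := τ) hv)
      (b := ENNReal.ofReal (ζ x ^ 2)) (Or.inr ENNReal.ofReal_ne_top)
    refine this.congr fun n => ?_
    rw [powerTest, ENNReal.ofReal_mul (truncatedPower_pos (hε n) _).le]
  calc ∫⁻ x in Ω, ENNReal.ofReal (‖gradient u x‖ * A ‖gradient u x‖) ^ (-τ) *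
        ENNReal.ofReal (ζ x ^ 2)
      = ∫⁻ x in Ω, liminf (fun n : ℕ =>
          ENNReal.ofReal (powerTest A u ζ τ (1 / ((n : ℝ) + 1)) x)) atTop := by
        refine lintegral_congr fun x => ?_
        rw [(hlim x).liminf_eq]
    -- Fatou's lemma along ε = 1/(n+1); the bound on the right does not depend on ε.
    _ ≤ liminf (fun n : ℕ => ∫⁻ x in Ω,
          ENNReal.ofReal (powerTest A u ζ τ (1 / ((n : ℝ) + 1)) x)) atTop :=
        lintegral_liminf_le fun n => (hcd n).continuous.measurable.ennreal_ofReal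
    _ ≤ _ := by
        refine liminf_le_of_le ⟨0, by simp⟩ fun b hb => ?_
        obtain ⟨n, hn⟩ := hb.exists
        refine hn.trans ?_
        rw [← ofReal_integral_eq_lintegral_ofReal
          ((hcd n).continuous.integrable_of_hasCompactSupport (hcs n)).integrableOn
          (Eventually.of_forall (h0 n))]
        exact ENNReal.ofReal_le_ofReal
          (h.integral_powerTest_le hc hτ hτ1 hL0 hΛ0 hζ (hε n) hL hΛ)

end IsSignedSolution

/-! ### Test functions that carry the kernel |x - y|^(-γ) -/

theorem EuclideanSpace.nontrivial_of_two_le {N : ℕ} (hN : 2 ≤ N) : Nontrivial (RSpace N) :=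
  Module.nontrivial_of_finrank_pos (R := ℝ) (by rw [finrank_euclideanSpace_fin]; omega)

theorem ContDiffBump.isTestFunction {N : ℕ} {x₀ : RSpace N} (b : ContDiffBump x₀)
    {Ω : Set (RSpace N)} (h : Metric.closedBall x₀ b.rOut ⊆ Ω) : IsTestFunction Ω b :=
  ⟨b.contDiff, b.hasCompactSupport, by rwa [b.tsupport_eq]⟩

/-- A regularization of `|x - y|^(-γ/2)`. -/
noncomputable def regularizedKernel {N : ℕ} (γ η : ℝ) (y x : RSpace N) : ℝ :=
  (η ^ 2 + ‖x - y‖ ^ 2) ^ (-γ / 4)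

section Kernel

variable {N : ℕ} {γ η : ℝ}

theorem contDiff_regularizedKernel (hη : 0 < η) (y : RSpace N) :
    ContDiff ℝ ∞ (regularizedKernel γ η y) :=
  (contDiff_const.add ((contDiff_id.sub contDiff_const).norm_sq ℝ)).rpow_const_of_ne
    fun x => by positivity

theorem gradient_regularizedKernel (hη : 0 < η) (y x : RSpace N) :
    gradient (regularizedKernel γ η y) x =
      (-γ / 4 * (η ^ 2 + ‖x - y‖ ^ 2) ^ (-γ / 4 - 1)) • ((2 : ℝ) • (x - y)) := by
  have h1 : HasGradientAt (fun x => η ^ 2 + ‖x - y‖ ^ 2) ((2 : ℝ) • (x - y)) x := by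
    rw [hasGradientAt_iff_hasFDerivAt]
    refine ((((hasFDerivAt_id x).sub_const y).norm_sq).const_add (η ^ 2)).congr_fderiv ?_
    ext w
    simp
  have h2 : HasDerivAt (fun q : ℝ => q ^ (-γ / 4))
      (-γ / 4 * (η ^ 2 + ‖x - y‖ ^ 2) ^ (-γ / 4 - 1)) (η ^ 2 + ‖x - y‖ ^ 2) :=
    Real.hasDerivAt_rpow_const (Or.inl (by positivity))
  exact (HasDerivAt.comp_hasGradientAt (f := fun x => η ^ 2 + ‖x - y‖ ^ 2) h2 h1).gradient

theorem sq_regularizedKernel (hη : 0 < η) (y x : RSpace N) :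
    regularizedKernel γ η y x ^ 2 = (η ^ 2 + ‖x - y‖ ^ 2) ^ (-γ / 2) := by
  rw [regularizedKernel, ← Real.rpow_natCast, ← Real.rpow_mul (by positivity)]
  congr 1
  push_cast
  ring

theorem rpow_add_sq_le {s r : ℝ} (hs : 0 ≤ s) (hr : 0 < r) :
    (η ^ 2 + r ^ 2) ^ (-s / 2) ≤ r ^ (-s) := by
  calc (η ^ 2 + r ^ 2) ^ (-s / 2) ≤ (r ^ 2) ^ (-s / 2) :=
        Real.rpow_le_rpow_of_nonpos (by positivity) (by nlinarith [sq_nonneg η]) (by linarith)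
    _ = r ^ (-s) := by
        rw [← Real.rpow_natCast, ← Real.rpow_mul hr.le]
        congr 1
        push_cast
        ring

theorem sq_norm_gradient_regularizedKernel_le (hγ : 0 ≤ γ) (hη : 0 < η) {y x : RSpace N}
    (hxy : x ≠ y) :
    ‖gradient (regularizedKernel γ η y) x‖ ^ 2 ≤ γ ^ 2 / 4 * ‖x - y‖ ^ (-(γ + 2)) := by
  have hr : 0 < ‖x - y‖ := norm_pos_iff.2 (sub_ne_zero.2 hxy)
  have hq : 0 < η ^ 2 + ‖x - y‖ ^ 2 := by positivity
  have e : ((η ^ 2 + ‖x - y‖ ^ 2) ^ (-γ / 4 - 1)) ^ 2 * (η ^ 2 + ‖x - y‖ ^ 2) =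
      (η ^ 2 + ‖x - y‖ ^ 2) ^ (-(γ + 2) / 2) := by
    rw [← Real.rpow_natCast, ← Real.rpow_mul hq.le, ← Real.rpow_add_one hq.ne']
    congr 1
    push_cast
    ring
  rw [gradient_regularizedKernel hη, norm_smul, norm_smul, mul_pow, mul_pow, Real.norm_eq_abs,
    Real.norm_eq_abs, sq_abs, sq_abs, mul_pow]
  calc (-γ / 4) ^ 2 * ((η ^ 2 + ‖x - y‖ ^ 2) ^ (-γ / 4 - 1)) ^ 2 * (2 ^ 2 * ‖x - y‖ ^ 2)
      = γ ^ 2 / 4 * (((η ^ 2 + ‖x - y‖ ^ 2) ^ (-γ / 4 - 1)) ^ 2 * ‖x - y‖ ^ 2) := by ring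
    _ ≤ γ ^ 2 / 4 * (((η ^ 2 + ‖x - y‖ ^ 2) ^ (-γ / 4 - 1)) ^ 2 *
        (η ^ 2 + ‖x - y‖ ^ 2)) := by
      gcongr
      linarith [sq_nonneg η]
    _ ≤ _ := by
      rw [e]
      gcongr
      exact rpow_add_sq_le (by linarith) hr

theorem integrable_indicator_rpow_norm (hN : 2 ≤ N) {s r : ℝ} (hs : s < N) :
    Integrable ((Metric.ball (0 : RSpace N) r).indicator fun z => ‖z‖ ^ (-s)) := by
  rw [integrable_indicator_iff Metric.isOpen_ball.measurableSet]
  refine integrableOn_ball_of_norm_le_rpow (C := 1) (α := s)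
    (by rw [finrank_euclideanSpace_fin]; omega) (by rwa [finrank_euclideanSpace_fin])
    (Eventually.of_forall fun z => ?_)
    (measurable_norm.pow_const _).aestronglyMeasurable
  rw [one_mul, Real.norm_of_nonneg (by positivity)]

/-- Cutoffs of the regularized kernels have uniformly bounded energy. -/
theorem exists_kernel_cutoff (hN : 2 ≤ N) (x₀ : RSpace N) {ρ : ℝ} (hρ : 0 < ρ) (hγ : 0 ≤ γ)
    (hγN : γ = 0 ∨ γ + 2 < N) :
    ∃ E : ℝ, ∀ y ∈ Metric.ball x₀ ρ, ∀ η : ℝ, 0 < η → ∃ ζ : RSpace N → ℝ,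
      IsTestFunction (Metric.ball x₀ (2 * ρ)) ζ ∧
      tsupport ζ ⊆ Metric.closedBall x₀ (3 * ρ / 2) ∧
      (∀ x ∈ Metric.ball x₀ ρ, ζ x ^ 2 = (η ^ 2 + ‖x - y‖ ^ 2) ^ (-γ / 2)) ∧
      ∫ x, (ζ x ^ 2 + ‖gradient ζ x‖ ^ 2) ≤ E := by
  let b : ContDiffBump x₀ := ⟨ρ, 3 * ρ / 2, hρ, by linarith⟩
  have hb : IsTestFunction (Metric.ball x₀ (2 * ρ)) b :=
    b.isTestFunction (Metric.closedBall_subset_ball (by change 3 * ρ / 2 < 2 * ρ; linarith))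
  have hbs : tsupport b = Metric.closedBall x₀ (3 * ρ / 2) := b.tsupport_eq
  have hb1 : ∀ x ∈ Metric.ball x₀ ρ, b x = 1 := fun x hx =>
    b.one_of_mem_closedBall (Metric.ball_subset_closedBall hx)
  rcases hγN with rfl | hγN
  -- For γ = 0 the plain bump suffices, which covers dimension 2.
  · exact ⟨_, fun y _ η hη => ⟨b, hb, hbs.le, fun x hx => by
      rw [hb1 x hx, neg_zero, zero_div, Real.rpow_zero, one_pow], le_rfl⟩⟩
  have := EuclideanSpace.nontrivial_of_two_le hN
  obtain ⟨P, hP⟩ := (continuous_gradient hb.contDiff_one).bounded_above_of_compact_support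
    (hb.2.1.of_isClosed_subset (isClosed_tsupport _) (closure_minimal (fun x hx => by
      by_contra h'
      exact hx (gradient_eq_zero_of_notMem_tsupport h')) (isClosed_tsupport _)))
  -- This majorant of the energy density is summable since γ + 2 < N. The radius 4ρ exceeds |x - y|
  -- < 3ρ/2 + ρ on the support of the bump.
  set k : RSpace N → ℝ := (Metric.ball (0 : RSpace N) (4 * ρ)).indicator
    fun z => ‖z‖ ^ (-(γ + 2)) with hk
  have hki : Integrable k := integrable_indicator_rpow_norm hN hγN
  set C := (1 + 2 * P ^ 2) * (4 * ρ) ^ 2 + γ ^ 2 / 2 with hC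
  refine ⟨C * ∫ z, k z, fun y hy η hη => ?_⟩
  set w := regularizedKernel γ η y with hw
  have hwc : ContDiff ℝ ∞ w := contDiff_regularizedKernel hη y
  have hts : tsupport (fun x => b x * w x) ⊆ tsupport b := tsupport_mul_subset_left
  have hζ : IsTestFunction (Metric.ball x₀ (2 * ρ)) (fun x => b x * w x) :=
    ⟨hb.1.mul hwc, hb.2.1.mul_right, hts.trans hb.2.2⟩
  refine ⟨fun x => b x * w x, hζ, hts.trans hbs.le, fun x hx => ?_, ?_⟩
  · dsimp only
    rw [hb1 x hx, one_mul, hw, sq_regularizedKernel hη]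
  -- Translating the majorant to y leaves its integral unchanged, whence the uniformity in y.
  · rw [← integral_const_mul, ← integral_sub_right_eq_self (fun z => C * k z) y]
    refine integral_mono_ae hζ.integrable_sq_add ((hki.const_mul C).comp_sub_right y) ?_
    have hne : ∀ᵐ x : RSpace N, x ≠ y := by
      simp [ae_iff, measure_singleton]
    filter_upwards [hne] with x hxy
    have hr : 0 < ‖x - y‖ := norm_pos_iff.2 (sub_ne_zero.2 hxy)
    have hk0 : 0 ≤ k (x - y) := indicator_nonneg (fun z _ => by positivity) _
    by_cases hx : x ∈ tsupport b
    · have hxy4 : ‖x - y‖ < 4 * ρ := by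
        rw [hbs, Metric.mem_closedBall] at hx
        rw [Metric.mem_ball'] at hy
        rw [← dist_eq_norm]
        linarith [dist_triangle x x₀ y]
      have hkx : k (x - y) = ‖x - y‖ ^ (-(γ + 2)) :=
        indicator_of_mem (by rwa [mem_ball_zero_iff]) _
      have hg : gradient (fun x => b x * w x) x = b x • gradient w x + w x • gradient b x :=
        ((hasGradientAt_of_contDiff hb.contDiff_one x).real_mul
          (hasGradientAt_of_contDiff (hwc.of_le (by norm_cast)) x)).gradient
      have hw2 : w x ^ 2 ≤ (4 * ρ) ^ 2 * k (x - y) := by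
        rw [hw, sq_regularizedKernel hη, hkx]
        refine (rpow_add_sq_le hγ hr).trans ?_
        have e : ‖x - y‖ ^ (-γ) = ‖x - y‖ ^ 2 * ‖x - y‖ ^ (-(γ + 2)) := by
          rw [← Real.rpow_natCast, ← Real.rpow_add hr]
          congr 1
          push_cast
          ring
        rw [e]
        gcongr
      have hgw : ‖gradient w x‖ ^ 2 ≤ γ ^ 2 / 4 * k (x - y) := by
        rw [hkx]
        exact sq_norm_gradient_regularizedKernel_le hγ hη hxy
      have hb01 : b x ^ 2 ≤ 1 := by
        have h0 := b.nonneg' x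
        have h1 : b x ≤ 1 := b.le_one
        nlinarith
      have hP2 : ‖gradient b x‖ ^ 2 ≤ P ^ 2 := pow_le_pow_left₀ (norm_nonneg _) (hP x) 2
      have hn : ‖gradient (fun x => b x * w x) x‖ ^ 2 ≤
          2 * (b x ^ 2 * ‖gradient w x‖ ^ 2) + 2 * (w x ^ 2 * ‖gradient b x‖ ^ 2) := by
        rw [hg]
        have h1 := pow_le_pow_left₀ (norm_nonneg _)
          (norm_add_le (b x • gradient w x) (w x • gradient b x)) 2
        refine h1.trans ((add_sq_le).trans (le_of_eq ?_))
        rw [norm_smul, norm_smul, mul_pow, mul_pow, Real.norm_eq_abs, Real.norm_eq_abs, sq_abs,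
          sq_abs]
        ring
      have h1 : b x ^ 2 * ‖gradient w x‖ ^ 2 ≤ 1 * (γ ^ 2 / 4 * k (x - y)) := by gcongr
      have h2 : w x ^ 2 * ‖gradient b x‖ ^ 2 ≤ (4 * ρ) ^ 2 * k (x - y) * P ^ 2 := by gcongr
      have h3 : b x ^ 2 * w x ^ 2 ≤ 1 * ((4 * ρ) ^ 2 * k (x - y)) := by gcongr
      rw [mul_pow, hC]
      linarith
    · rw [gradient_eq_zero_of_notMem_tsupport fun h' => hx (hts h'),
        image_eq_zero_of_notMem_tsupport hx]
      have : 0 ≤ C := by positivity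
      simp only [zero_mul, norm_zero, ne_eq, OfNat.ofNat_ne_zero, not_false_eq_true, zero_pow,
        add_zero]
      positivity

theorem tendsto_regularized_rpow {r : ℝ} (hr : 0 ≤ r) :
    Tendsto (fun n : ℕ => ENNReal.ofReal (((1 / ((n : ℝ) + 1)) ^ 2 + r ^ 2) ^ (-γ / 2))) atTop
      (𝓝 (ENNReal.ofReal r ^ (-γ))) := by
  have h1 : ∀ n : ℕ, ENNReal.ofReal (((1 / ((n : ℝ) + 1)) ^ 2 + r ^ 2) ^ (-γ / 2)) =
      ENNReal.ofReal ((1 / ((n : ℝ) + 1)) ^ 2 + r ^ 2) ^ (-γ / 2) := fun n => by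
    rw [ENNReal.ofReal_rpow_of_pos (by positivity)]
  simp only [h1]
  have h2 : ENNReal.ofReal r ^ (-γ) = ENNReal.ofReal (0 ^ 2 + r ^ 2) ^ (-γ / 2) := by
    rw [zero_pow two_ne_zero, zero_add, ENNReal.ofReal_pow hr,
      ← ENNReal.rpow_natCast, ← ENNReal.rpow_mul]
    congr 1
    push_cast
    ring
  rw [h2]
  refine (ENNReal.continuous_rpow_const.tendsto _).comp (ENNReal.tendsto_ofReal ?_)
  have h3 : Continuous fun e : ℝ => e ^ 2 + r ^ 2 := by fun_prop
  exact (h3.tendsto 0).comp tendsto_one_div_add_atTop_nhds_zero_nat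

end Kernel

/-! ### Negligibility of the critical set and the kernel estimate -/

namespace IsSignedSolution

variable {N : ℕ} {x₀ : RSpace N} {ρ m M K θ Chat c F : ℝ} {Ω : Set (RSpace N)} {A B : ℝ → ℝ}
  {f u : RSpace N → ℝ}

theorem aemeasurable_rpow (h : IsSignedSolution x₀ ρ m M K θ Chat c F Ω A B f u) (τ : ℝ) :
    AEMeasurable (fun x => ENNReal.ofReal (‖gradient u x‖ * A ‖gradient u x‖) ^ (-τ))
      (volume.restrict Ω) := by
  have h1 := h.continuousOn_flux.norm.aemeasurable (μ := volume) h.isOpen.measurableSet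
  simp only [h.norm_flux] at h1
  exact h1.ennreal_ofReal.pow_const _

/-- On the critical set |V|^(-1/2) = ∞, while its integral against the square of a bump is finite.
The argument is local because |∇u| is only known to be bounded on compact subsets. -/
theorem volume_criticalSet (h : IsSignedSolution x₀ ρ m M K θ Chat c F Ω A B f u) (hc : 0 < c) :
    volume (Metric.ball x₀ (2 * ρ) ∩ criticalSet u) = 0 := by
  refine measure_null_of_locally_null _ fun x hx => ?_
  obtain ⟨r, hr, hrs⟩ := Metric.isOpen_iff.1 Metric.isOpen_ball x hx.1
  let b : ContDiffBump x := ⟨r / 4, r / 2, by positivity, by linarith⟩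
  have hb : IsTestFunction (Metric.ball x₀ (2 * ρ)) b :=
    b.isTestFunction ((Metric.closedBall_subset_ball
      (by change r / 2 < r; linarith)).trans hrs)
  have hbΩ := hb.mono h.ball_subset
  have hK : IsCompact (tsupport b) := hb.2.1
  obtain ⟨L, hL⟩ := hK.exists_bound_of_continuousOn (h.continuousOn_gradient.mono hbΩ.2.2)
  obtain ⟨Λ, hΛ⟩ := hK.exists_bound_of_continuousOn (h.continuousOn_flux.mono hbΩ.2.2)
  have hM := h.lintegral_rpow_le hc (τ := 1 / 2) (by norm_num) (by norm_num) (abs_nonneg L)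
    (abs_nonneg Λ) hb (fun x hx => (hL x hx).trans (le_abs_self L)) fun x hx => by
      rw [← h.norm_flux]; exact (hΛ x hx).trans (le_abs_self Λ)
  have hlt := ae_lt_top' ((h.aemeasurable_rpow (1 / 2)).mul
    (hb.1.continuous.pow 2).measurable.ennreal_ofReal.aemeasurable)
    (hM.trans_lt ENNReal.ofReal_lt_top).ne
  rw [ae_restrict_iff' h.isOpen.measurableSet, ae_iff] at hlt
  refine ⟨Metric.ball x (r / 4) ∩ (Metric.ball x₀ (2 * ρ) ∩ criticalSet u),
    Filter.inter_mem (mem_nhdsWithin_of_mem_nhds (Metric.ball_mem_nhds x (by positivity)))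
      self_mem_nhdsWithin, measure_mono_null (fun z hz => ?_) hlt⟩
  have hz0 : gradient u z = 0 := hz.2.2
  have hb1 : b z = 1 := b.one_of_mem_closedBall (Metric.ball_subset_closedBall hz.1)
  intro hcon
  have := hcon (h.ball_subset hz.2.1)
  simp [hz0, hb1] at this

theorem lintegral_rpow_kernel_le (h : IsSignedSolution x₀ ρ m M K θ Chat c F Ω A B f u)
    (hc : 0 < c) {τ L Λ γ E : ℝ} (hτ : 0 < τ) (hτ1 : τ < 1) (hL0 : 0 ≤ L) (hΛ0 : 0 ≤ Λ)
    (hL : ∀ x ∈ Metric.closedBall x₀ (3 * ρ / 2), ‖gradient u x‖ ≤ L)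
    (hΛ : ∀ x ∈ Metric.closedBall x₀ (3 * ρ / 2), ‖gradient u x‖ * A ‖gradient u x‖ ≤ Λ)
    (hρ : 0 < ρ) {y : RSpace N}
    (hE : ∀ η : ℝ, 0 < η → ∃ ζ : RSpace N → ℝ,
      IsTestFunction (Metric.ball x₀ (2 * ρ)) ζ ∧
      tsupport ζ ⊆ Metric.closedBall x₀ (3 * ρ / 2) ∧
      (∀ x ∈ Metric.ball x₀ ρ, ζ x ^ 2 = (η ^ 2 + ‖x - y‖ ^ 2) ^ (-γ / 2)) ∧
      ∫ x, (ζ x ^ 2 + ‖gradient ζ x‖ ^ 2) ≤ E) (hγ : 0 ≤ γ) :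
    ∫⁻ x in Metric.ball x₀ ρ, ENNReal.ofReal (‖gradient u x‖ * A ‖gradient u x‖) ^ (-τ) *
        ENNReal.ofReal ‖x - y‖ ^ (-γ) ≤
      ENNReal.ofReal (summabilityConstant N m M τ Chat F L Λ c * E) := by
  have hsub : Metric.ball x₀ ρ ⊆ Ω :=
    (Metric.ball_subset_ball (by linarith)).trans h.ball_subset
  have hS0 : 0 ≤ summabilityConstant N m M τ Chat F L Λ c := by
    have h1 := hessianConstant_nonneg N (m := m) (M := M) (τ := τ) (Chat := Chat) (F := F) (L := L)
      (Λ := Λ) h.admissibleA.neg_one_lt hτ1 h.admissibleB.Chat_pos.le hΛ0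
    have h2 : 0 < 1 - τ := by linarith
    have h3 := h.admissibleB.Chat_pos
    unfold summabilityConstant
    positivity
  have hm : AEMeasurable (fun x => ENNReal.ofReal (‖gradient u x‖ * A ‖gradient u x‖) ^ (-τ))
      (volume.restrict (Metric.ball x₀ ρ)) :=
    (h.aemeasurable_rpow τ).mono_measure (Measure.restrict_mono hsub le_rfl)
  have hlim : ∀ x, Tendsto (fun n : ℕ =>
      ENNReal.ofReal (‖gradient u x‖ * A ‖gradient u x‖) ^ (-τ) *
        ENNReal.ofReal (((1 / ((n : ℝ) + 1)) ^ 2 + ‖x - y‖ ^ 2) ^ (-γ / 2))) atTop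
      (𝓝 (ENNReal.ofReal (‖gradient u x‖ * A ‖gradient u x‖) ^ (-τ) *
        ENNReal.ofReal ‖x - y‖ ^ (-γ))) := fun x => by
    -- The kernel may tend to ∞ at x = y, so the other factor must be nonzero; it is, being a
    -- negative power of a finite number.
    refine ENNReal.Tendsto.const_mul (tendsto_regularized_rpow (norm_nonneg _)) (Or.inl ?_)
    rw [Ne, ENNReal.rpow_eq_zero_iff]
    push Not
    exact ⟨fun _ => by linarith, fun h' => absurd h' ENNReal.ofReal_ne_top⟩
  calc ∫⁻ x in Metric.ball x₀ ρ, ENNReal.ofReal (‖gradient u x‖ * A ‖gradient u x‖) ^ (-τ) *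
        ENNReal.ofReal ‖x - y‖ ^ (-γ)
      = ∫⁻ x in Metric.ball x₀ ρ, liminf (fun n : ℕ =>
          ENNReal.ofReal (‖gradient u x‖ * A ‖gradient u x‖) ^ (-τ) *
            ENNReal.ofReal (((1 / ((n : ℝ) + 1)) ^ 2 + ‖x - y‖ ^ 2) ^ (-γ / 2))) atTop := by
        refine lintegral_congr fun x => ?_
        rw [(hlim x).liminf_eq]
    _ ≤ liminf (fun n : ℕ => ∫⁻ x in Metric.ball x₀ ρ,
          ENNReal.ofReal (‖gradient u x‖ * A ‖gradient u x‖) ^ (-τ) *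
            ENNReal.ofReal (((1 / ((n : ℝ) + 1)) ^ 2 + ‖x - y‖ ^ 2) ^ (-γ / 2))) atTop := by
        refine lintegral_liminf_le' fun n => hm.mul ?_
        refine (Measurable.ennreal_ofReal ?_).aemeasurable
        exact (measurable_const.add ((measurable_id.sub_const y).norm.pow_const 2)).pow_const _
    _ ≤ _ := by
        refine liminf_le_of_le ⟨0, by simp⟩ fun b hb => ?_
        obtain ⟨n, hn⟩ := hb.exists
        refine hn.trans ?_
        obtain ⟨ζ, hζ, hζs, hζe, hζE⟩ := hE (1 / ((n : ℝ) + 1)) (by positivity)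
        calc ∫⁻ x in Metric.ball x₀ ρ, ENNReal.ofReal (‖gradient u x‖ * A ‖gradient u x‖) ^ (-τ) *
              ENNReal.ofReal (((1 / ((n : ℝ) + 1)) ^ 2 + ‖x - y‖ ^ 2) ^ (-γ / 2))
            = ∫⁻ x in Metric.ball x₀ ρ,
              ENNReal.ofReal (‖gradient u x‖ * A ‖gradient u x‖) ^ (-τ) *
                ENNReal.ofReal (ζ x ^ 2) :=
              setLIntegral_congr_fun Metric.isOpen_ball.measurableSet fun x hx => by
                simp only [hζe x hx]
          _ ≤ ∫⁻ x in Ω, ENNReal.ofReal (‖gradient u x‖ * A ‖gradient u x‖) ^ (-τ) *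
                ENNReal.ofReal (ζ x ^ 2) := lintegral_mono_set hsub
          _ ≤ _ := h.lintegral_rpow_le hc hτ hτ1 hL0 hΛ0 hζ (fun x hx => hL x (hζs hx))
              fun x hx => hΛ x (hζs hx)
          _ ≤ _ := by
              refine ENNReal.ofReal_le_ofReal (mul_le_mul_of_nonneg_left ?_ hS0)
              exact (setIntegral_le_integral hζ.integrable_sq_add
                (Eventually.of_forall fun x => by positivity)).trans hζE

end IsSignedSolution

/-! ### From powers of |∇u| A(|∇u|) to powers of A, and the conclusion -/

/-- Split A^(-σ) = A^(-(σ-τ)) A^(-τ) and use the lower bound A ≥ K t^θ in the first factor only. The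
leftover power of t has a nonnegative exponent and is controlled by L. -/
theorem AdmissibleA.rpow_neg_le {A : ℝ → ℝ} {m M K θ σ τ L t : ℝ} (hA : AdmissibleA A m M K θ)
    (hτσ : τ ≤ σ) (he : 0 ≤ τ - θ * (σ - τ)) (ht : 0 < t) (htL : t ≤ L) :
    A t ^ (-σ) ≤ K ^ (-(σ - τ)) * L ^ (τ - θ * (σ - τ)) * (t * A t) ^ (-τ) := by
  have hAt := hA.pos t ht
  have hK := hA.K_pos
  have h1 : A t ^ (-(σ - τ)) ≤ (K * t ^ θ) ^ (-(σ - τ)) :=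
    Real.rpow_le_rpow_of_nonpos (by positivity) (hA.lower_bound t ht) (by linarith)
  have h2 : (K * t ^ θ) ^ (-(σ - τ)) = K ^ (-(σ - τ)) * t ^ (-(θ * (σ - τ))) := by
    rw [Real.mul_rpow hK.le (by positivity), ← Real.rpow_mul ht.le]
    ring_nf
  have h3 : A t ^ (-σ) = A t ^ (-(σ - τ)) * A t ^ (-τ) := by
    rw [← Real.rpow_add hAt]
    ring_nf
  have h4 : t ^ (-(θ * (σ - τ))) * A t ^ (-τ) = t ^ (τ - θ * (σ - τ)) * (t * A t) ^ (-τ) := by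
    rw [Real.mul_rpow ht.le hAt.le, ← mul_assoc, ← Real.rpow_add ht]
    ring_nf
  have h5 : t ^ (τ - θ * (σ - τ)) ≤ L ^ (τ - θ * (σ - τ)) := Real.rpow_le_rpow ht.le htL he
  have hL : 0 < L := ht.trans_le htL
  calc A t ^ (-σ) = A t ^ (-(σ - τ)) * A t ^ (-τ) := h3
    _ ≤ (K * t ^ θ) ^ (-(σ - τ)) * A t ^ (-τ) := by gcongr
    _ = K ^ (-(σ - τ)) * (t ^ (-(θ * (σ - τ))) * A t ^ (-τ)) := by rw [h2, mul_assoc]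
    _ = K ^ (-(σ - τ)) * t ^ (τ - θ * (σ - τ)) * (t * A t) ^ (-τ) := by rw [h4, mul_assoc]
    _ ≤ _ := by gcongr

/-- The summability estimate, with a constant that only depends on bounds for `|∇u|` and
`|∇u| A(|∇u|)` on a fixed smaller ball. -/
theorem exists_inverseWeightIntegral_le {N : ℕ} (hN : 2 ≤ N) (x₀ : RSpace N) {ρ : ℝ} (hρ : 0 < ρ)
    (m M K θ Chat c F : ℝ) (hc : 0 < c) {σ γ : ℝ} (hσ : 1 < σ) (hσθ : (σ - 1) * θ < 1)
    (hγ : (N = 2 ∧ γ = 0) ∨ (3 ≤ N ∧ γ < (N : ℝ) - 2)) {L Λ : ℝ} (hL0 : 0 ≤ L) (hΛ0 : 0 ≤ Λ) :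
    ∃ C : ℝ≥0, ∀ (Ω : Set (RSpace N)) (A B : ℝ → ℝ) (f u : RSpace N → ℝ),
      IsSignedSolution x₀ ρ m M K θ Chat c F Ω A B f u →
      (∀ x ∈ Metric.closedBall x₀ (3 * ρ / 2), ‖gradient u x‖ ≤ L) →
      (∀ x ∈ Metric.closedBall x₀ (3 * ρ / 2), ‖gradient u x‖ * A ‖gradient u x‖ ≤ Λ) →
      ∀ y ∈ Metric.ball x₀ ρ, inverseWeightIntegral x₀ ρ A u σ γ y ≤ (C : ℝ≥0∞) := by
  rcases lt_or_ge θ 0 with hθ | hθ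
  · exact ⟨0, fun Ω A B f u h => absurd h.admissibleA.theta_nonneg (not_le.2 hθ)⟩
  -- A negative γ gives a kernel bounded by (2ρ)^|γ|, so it reduces to exponent zero; `K₂` below
  -- accounts for both cases.
  have hγ' : max γ 0 = 0 ∨ max γ 0 + 2 < N := by
    rcases hγ with ⟨-, rfl⟩ | ⟨-, hγN⟩
    · left; simp
    · rcases le_total γ 0 with h | h
      · left; exact max_eq_right h
      · right; rw [max_eq_left h]; linarith
  obtain ⟨E, hE⟩ := exists_kernel_cutoff hN x₀ hρ (le_max_right γ 0) hγ'
  -- The second entry is the least τ with τ ≥ θ(σ-τ), and it is below 1 because (σ-1)θ < 1. The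
  -- entry 1/2 keeps τ positive when θ = 0.
  set τ := max (1 / 2) (θ * σ / (1 + θ)) with hτdef
  have hτ : 0 < τ := lt_max_of_lt_left (by norm_num)
  have hτ1 : τ < 1 := by
    refine max_lt (by norm_num) ?_
    rw [div_lt_one (by linarith)]
    linarith
  have he : 0 ≤ τ - θ * (σ - τ) := by
    have : θ * σ / (1 + θ) ≤ τ := le_max_right _ _
    rw [div_le_iff₀ (by linarith)] at this
    linarith
  set K₁ : ℝ≥0∞ := ENNReal.ofReal (K ^ (-(σ - τ)) * L ^ (τ - θ * (σ - τ))) with hK₁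
  set K₂ : ℝ≥0∞ := 1 + ENNReal.ofReal (2 * ρ) ^ |γ| with hK₂
  have hK₂top : K₂ ≠ ⊤ :=
    ENNReal.add_ne_top.2 ⟨ENNReal.one_ne_top, ENNReal.rpow_ne_top_of_nonneg (abs_nonneg _)
      ENNReal.ofReal_ne_top⟩
  have hC : K₁ * K₂ * ENNReal.ofReal (IsSignedSolution.summabilityConstant N m M τ Chat F L Λ c *
      E) ≠ ⊤ :=
    ENNReal.mul_ne_top (ENNReal.mul_ne_top ENNReal.ofReal_ne_top hK₂top) ENNReal.ofReal_ne_top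
  refine ⟨(K₁ * K₂ * ENNReal.ofReal (IsSignedSolution.summabilityConstant N m M τ Chat F L Λ c *
      E)).toNNReal, fun Ω A B f u h hL hΛ y hy => ?_⟩
  rw [ENNReal.coe_toNNReal hC]
  have hA := h.admissibleA
  -- The pointwise comparison needs |∇u| > 0, as nothing is known about A(0).
  have hcrit : ∀ᵐ x, ¬ (x ∈ Metric.ball x₀ (2 * ρ) ∩ criticalSet u) :=
    measure_eq_zero_iff_ae_notMem.1 (h.volume_criticalSet hc)
  refine le_trans ?_ (mul_le_mul_right (h.lintegral_rpow_kernel_le hc hτ hτ1 hL0 hΛ0 hL hΛ hρ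
    (hE y hy) (le_max_right γ 0)) (K₁ * K₂))
  rw [← lintegral_const_mul' _ _ (ENNReal.mul_ne_top ENNReal.ofReal_ne_top hK₂top),
    inverseWeightIntegral]
  refine lintegral_mono_ae ?_
  filter_upwards [ae_restrict_of_ae hcrit, ae_restrict_mem Metric.isOpen_ball.measurableSet]
    with x hx hxb
  have hxb2 : x ∈ Metric.ball x₀ (2 * ρ) := Metric.ball_subset_ball (by linarith) hxb
  have ht : 0 < ‖gradient u x‖ := norm_pos_iff.2 fun h0 => hx ⟨hxb2, h0⟩
  have hAt := hA.pos _ ht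
  have htL := hL x (Metric.ball_subset_closedBall (Metric.ball_subset_ball (by linarith) hxb))
  have hKp := hA.K_pos
  have b1 : ENNReal.ofReal (A ‖gradient u x‖) ^ (-σ) ≤
      K₁ * ENNReal.ofReal (‖gradient u x‖ * A ‖gradient u x‖) ^ (-τ) := by
    rw [ENNReal.ofReal_rpow_of_pos hAt, ENNReal.ofReal_rpow_of_pos (mul_pos ht hAt), hK₁,
      ← ENNReal.ofReal_mul (by positivity)]
    exact ENNReal.ofReal_le_ofReal (hA.rpow_neg_le (hτ1.le.trans hσ.le) he ht htL)
  have b2 : ENNReal.ofReal ‖x - y‖ ^ (-γ) ≤ K₂ * ENNReal.ofReal ‖x - y‖ ^ (-max γ 0) := by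
    rcases le_total γ 0 with h0 | h0
    · rw [max_eq_right h0, neg_zero, ENNReal.rpow_zero, mul_one, hK₂, abs_of_nonpos h0]
      refine le_add_left (ENNReal.rpow_le_rpow (ENNReal.ofReal_le_ofReal ?_) (by linarith))
      rw [← dist_eq_norm]
      rw [Metric.mem_ball] at hxb
      rw [Metric.mem_ball'] at hy
      linarith [dist_triangle x x₀ y]
    · rw [max_eq_left h0]
      exact le_mul_of_one_le_left' (le_add_right le_rfl)
  calc ENNReal.ofReal (A ‖gradient u x‖) ^ (-σ) * ENNReal.ofReal ‖x - y‖ ^ (-γ)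
      ≤ (K₁ * ENNReal.ofReal (‖gradient u x‖ * A ‖gradient u x‖) ^ (-τ)) *
        (K₂ * ENNReal.ofReal ‖x - y‖ ^ (-max γ 0)) := mul_le_mul' b1 b2
    _ = _ := by ring

theorem corollary1p2 (N : ℕ) (hN : 2 ≤ N) (x₀ : RSpace N) (ρ : ℝ) (hρ : 0 < ρ)
    (m M K θ Chat c F : ℝ) (hc : 0 < c) :
    -- the summability estimate
    (∀ σ γ : ℝ, 1 < σ → (σ - 1) * θ < 1 → ((N = 2 ∧ γ = 0) ∨ (3 ≤ N ∧ γ < (N : ℝ) - 2)) →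
      -- with a constant that depends on the solution only through the listed parameters
      (∀ L Λ : ℝ, ∃ C : ℝ≥0, ∀ (Ω : Set (RSpace N)) (A B : ℝ → ℝ) (f u : RSpace N → ℝ),
        IsSignedSolution x₀ ρ m M K θ Chat c F Ω A B f u →
        (∀ x ∈ Metric.ball x₀ (2 * ρ), ‖gradient u x‖ ≤ L) →
        (∀ t : ℝ, 0 < t → t ≤ L → t * A t ≤ Λ) →
        ∀ y ∈ Metric.ball x₀ ρ, inverseWeightIntegral x₀ ρ A u σ γ y ≤ (C : ℝ≥0∞)) ∧
      -- and, uniformly in `y`, even if the gradient is unbounded near the boundary of the ball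
      (∀ (Ω : Set (RSpace N)) (A B : ℝ → ℝ) (f u : RSpace N → ℝ),
        IsSignedSolution x₀ ρ m M K θ Chat c F Ω A B f u →
        ∃ C : ℝ≥0, ∀ y ∈ Metric.ball x₀ ρ, inverseWeightIntegral x₀ ρ A u σ γ y ≤ (C : ℝ≥0∞))) ∧
    -- the zero set of the weight and the critical set are negligible
    (∀ (Ω : Set (RSpace N)) (A B : ℝ → ℝ) (f u : RSpace N → ℝ),
      IsSignedSolution x₀ ρ m M K θ Chat c F Ω A B f u →
      volume {x ∈ Metric.ball x₀ (2 * ρ) | A ‖gradient u x‖ = 0} = 0 ∧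
      volume (Metric.ball x₀ (2 * ρ) ∩ criticalSet u) = 0) := by
  have hsub : Metric.closedBall x₀ (3 * ρ / 2) ⊆ Metric.ball x₀ (2 * ρ) :=
    Metric.closedBall_subset_ball (by linarith)
  refine ⟨fun σ γ hσ hσθ hγ => ⟨fun L Λ => ?_, fun Ω A B f u h => ?_⟩, fun Ω A B f u h => ?_⟩
  · obtain ⟨C, hC⟩ := exists_inverseWeightIntegral_le hN x₀ hρ m M K θ Chat c F hc hσ hσθ hγ
      (abs_nonneg L) (abs_nonneg Λ)
    refine ⟨C, fun Ω A B f u h hL hΛ => hC Ω A B f u h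
      (fun x hx => (hL x (hsub hx)).trans (le_abs_self L)) fun x hx => ?_⟩
    rcases (norm_nonneg (gradient u x)).eq_or_lt with h0 | h0
    · rw [← h0, zero_mul]; exact abs_nonneg Λ
    · exact (hΛ _ h0 (hL x (hsub hx))).trans (le_abs_self Λ)
  -- Without a gradient bound on the large ball, continuity of ∇u and of the flux on this compact
  -- ball supplies L and Λ.
  · have hK : IsCompact (Metric.closedBall x₀ (3 * ρ / 2)) := isCompact_closedBall _ _
    have hΩ := hsub.trans h.ball_subset
    obtain ⟨L, hL⟩ := hK.exists_bound_of_continuousOn (h.continuousOn_gradient.mono hΩ)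
    obtain ⟨Λ, hΛ⟩ := hK.exists_bound_of_continuousOn (h.continuousOn_flux.mono hΩ)
    obtain ⟨C, hC⟩ := exists_inverseWeightIntegral_le hN x₀ hρ m M K θ Chat c F hc hσ hσθ hγ
      (abs_nonneg L) (abs_nonneg Λ)
    refine ⟨C, hC Ω A B f u h (fun x hx => (hL x hx).trans (le_abs_self L)) fun x hx => ?_⟩
    rw [← h.norm_flux]
    exact (hΛ x hx).trans (le_abs_self Λ)
  · have hcrit := h.volume_criticalSet hc
    refine ⟨measure_mono_null (fun x hx => ?_) hcrit, hcrit⟩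
    refine ⟨hx.1, by_contra fun h0 => ?_⟩
    exact (h.admissibleA.pos _ (norm_pos_iff.2 h0)).ne' hx.2
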